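/- **Setting.** Let $\omega:[0,\infty)\to[0,\infty)$ be a normalized Braun–Meise–Taylor weight function: $\omega$ is continuous and non-decreasing, $\omega(t)=0$ for $t\in[0,1]$, $\omega(t)\to\infty$ and $\log t=o(\omega(t))$ as $t\to\infty$, and $y\mapsto\omega(e^y)$ is convex on $\mathbb R$. Assume that $t=o(\omega(t))$ as $t\to\infty$ and that $\overline\gamma(\omega)<1$, where $$\overline\gamma(\omega)=\inf\Big\{\gamma>0:\ \exists A>1,\ \liminf_{t\to\infty}\frac{\omega(A^\gamma t)}{\omega(t)}>A\Big\}\qquad(\inf\emptyset=+\infty).$$ **Conjugates.** For a weight function $\sigma$ put $\sigma^*(s)=\sup_{t\ge0}(st-\sigma(t))$ and $\varphi^*_\sigma(x)=\sup_{y\ge0}(xy-\sigma(e^y))$. For a sequence $M=(M_p)_{p\in\mathbb N}$ of positive numbers put $M^*_p=p!/M_p$ and $\omega_M(t)=\sup_{p\in\mathbb N}\log(M_0t^p/M_p)$ (with $\omega_M(0)=0$). Write $M\approx N$ if $\sup_{p\ge1}(M_p/N_p)^{1/p}<\infty$ and $\sup_{p\ge1}(N_p/M_p)^{1/p}<\infty$.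 Let $\mathcal{LC}$ be the set of log-convex sequences of positive numbers with $1=M_0\le M_1$ and $M_p^{1/p}\to\infty$. For $\ell>0$ let $W^{(\ell)}_p=\exp\big(\tfrac1\ell\varphi^*_\omega(\ell p)\big)$, and let $\mathcal M^*_\omega=\{(W^{(1/\ell)})^*:\ell>0\}$. **Function spaces.** Let $U\subseteq\mathbb R^d$ be open. For a family $a=(a_i)_i$ of sequences of positive numbers consider the smooth functions $f:U\to\mathbb C$ such that for every compact $K\subseteq U$ $$\|f\|_{K,i}=\sup_{x\in K,\ \alpha\in\mathbb N^d}\frac{|f^{(\alpha)}(x)|}{a_i(|\alpha|)}<\infty$$ for some $i$ (Roumieu case) or for all $i$ (Beurling case). The Roumieu space carries the topology of the projective limit over the compact sets $K\subseteq U$ (with regular boundary) of the locally convex inductive limits over $i$ of the normed spaces of smooth functions on $K$ with finite norm $\|\cdot\|_{K,i}$; the Beurling space carries the topology defined by all seminorms $\|\cdot\|_{K,i}$. The symbol $[\cdot]$ stands for either case. The space $\mathcal E_{[\sigma]}(U)$ of a weight function $\sigma$ is given by the family $\exp(\frac1\ell\varphi^*_\sigma(\ell p))$, $\ell>0$; the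 space $\mathcal E_{[M]}(U)$ of a sequence $M$ by the family $h^pM_p$, $h>0$; the space $\mathcal E_{[\mathcal M]}(U)$ of $\mathcal M=\{M^{(\ell)}:\ell>0\}$ by the family $h^pM^{(\ell)}_p$, $\ell,h>0$. **Theorem.** For every $\ell>0$ there is a sequence $V^{(\ell)}$ of positive numbers with $V^{(\ell)}\approx W^{(\ell)}$ such that $V^{(\ell)}$ is log-convex, $(V^{(\ell)}_p/p!)_p$ is log-concave, and even $V^{(\ell)},(V^{(\ell)})^*\in\mathcal{LC}$. Moreover, for any choice of sequences $V^{(\ell)}$, $\ell>0$, of positive numbers with $V^{(\ell)}\approx W^{(\ell)}$, $V^{(\ell)}$ log-convex and $(V^{(\ell)}_p/p!)_p$ log-concave, let $\mathcal V^*=\{(V^{(1/\ell)})^*:\ell>0\}$. Then, in the Roumieu case as well as in the Beurling case, for every open $U\subseteq\mathbb R^d$, $d\in\mathbb N$, and every $\ell>0$, $$\mathcal E_{[\omega^*]}(U)=\mathcal E_{[(\omega_{W^{(\ell)}})^*]}(U)=\mathcal E_{[\omega_{(W^{(\ell)})^*}]}(U)=\mathcal E_{[\omega_{(V^{(\ell)})^*}]}(U)=\mathcal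 E_{[\mathcal V^*]}(U)=\mathcal E_{[\mathcal M^*_\omega]}(U)=\mathcal E_{[(W^{(\ell)})^*]}(U)$$ as locally convex vector spaces, that is, these spaces consist of the same functions and carry the same topology. -/

import Mathlib

open Filter Topology

noncomputable section

/-! ### Weight functions

A weight function `[0,∞) → [0,∞)` is given by a function `ℝ → ℝ`; only its values at `t ≥ 0` are
ever used. -/

/-- Normalized Braun-Meise-Taylor weight functions. Nonnegativity on `[0,∞)` follows from
monotonicity and the vanishing on `[0,1]`. -/
structure IsBMTWeight (ω : ℝ → ℝ) : Prop where
  continuousOn : ContinuousOn ω (Set.Ici 0)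
  monotoneOn : MonotoneOn ω (Set.Ici 0)
  eq_zero : ∀ t ∈ Set.Icc (0 : ℝ) 1, ω t = 0
  tendsto_atTop : Tendsto ω atTop atTop
  log_isLittleO : Real.log =o[atTop] ω
  convexOn_exp : ConvexOn ℝ Set.univ (fun t : ℝ => ω (Real.exp t))

/-- `∃ A > 1, liminf_{t → ∞} ω (A ^ γ t) / ω t > A`, the lower limit being taken in `[-∞,∞]`. -/
def HasUpperProperty (ω : ℝ → ℝ) (γ : ℝ) : Prop :=
  ∃ A : ℝ, 1 < A ∧
    (A : EReal) < liminf (fun t : ℝ => ((ω (A ^ γ * t) / ω t : ℝ) : EReal)) atTop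

/-- The upper growth index of `ω`, with value `+∞` if the set of admissible `γ` is empty. -/
def upperIndex (ω : ℝ → ℝ) : EReal :=
  ⨅ γ ∈ {γ : ℝ | 0 < γ ∧ HasUpperProperty ω γ}, (γ : EReal)

/-- The conjugate weight function `ω* (s) = sup_{t ≥ 0} (s t - ω t)`; the supremum is finite for
all `s ≥ 0` as soon as `t = o(ω t)`. -/
def conjWeight (ω : ℝ → ℝ) (s : ℝ) : ℝ :=
  sSup ((fun t : ℝ => s * t - ω t) '' Set.Ici 0)

/-- The Young conjugate `x ↦ sup_{y ≥ 0} (x y - φ y)` of `φ y = ω (exp y)`. -/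
def youngConj (ω : ℝ → ℝ) (x : ℝ) : ℝ :=
  sSup ((fun y : ℝ => x * y - ω (Real.exp y)) '' Set.Ici 0)

/-- The associated weight matrix: its `ℓ`-th sequence (`ℓ > 0`) is `p ↦ exp (φ* (ℓ p) / ℓ)`. -/
def assocMatrix (ω : ℝ → ℝ) (ℓ : ℝ) (p : ℕ) : ℝ :=
  Real.exp (1 / ℓ * youngConj ω (ℓ * p))

/-! ### Weight sequences -/

/-- The associated function `ω_M (t) = sup_p log (M_0 t^p / M_p)`. At `t = 0` every term of the
supremum is `0` (as `Real.log 0 = 0`), in accordance with `ω_M (0) = 0`. -/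
def assocWeight (M : ℕ → ℝ) (t : ℝ) : ℝ :=
  ⨆ p : ℕ, Real.log (M 0 * t ^ p / M p)

/-- The conjugate sequence `M*_p = p! / M_p`. -/
def conjSeq (M : ℕ → ℝ) (p : ℕ) : ℝ := (p.factorial : ℝ) / M p

def IsLogConvex (M : ℕ → ℝ) : Prop :=
  ∀ p : ℕ, M (p + 1) ^ 2 ≤ M p * M (p + 2)

def IsLogConcave (M : ℕ → ℝ) : Prop :=
  ∀ p : ℕ, M p * M (p + 2) ≤ M (p + 1) ^ 2

/-- The class of normalized log-convex sequences of positive numbers with `M_p ^ (1/p) → ∞`. -/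
structure IsLC (M : ℕ → ℝ) : Prop where
  pos : ∀ p, 0 < M p
  zero_eq_one : M 0 = 1
  one_le : 1 ≤ M 1
  logConvex : IsLogConvex M
  tendsto_root : Tendsto (fun p : ℕ => M p ^ (1 / (p : ℝ))) atTop atTop

/-- `sup_{p ≥ 1} (M_p / N_p) ^ (1/p) < ∞`. -/
def SeqLE (M N : ℕ → ℝ) : Prop :=
  BddAbove ((fun p : ℕ => (M p / N p) ^ (1 / (p : ℝ))) '' Set.Ici 1)

def SeqEquiv (M N : ℕ → ℝ) : Prop := SeqLE M N ∧ SeqLE N M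

/-- `V` is a log-convex sequence equivalent to `W` such that `v_p = V_p / p!` is log-concave. -/
structure IsRegularization (W V : ℕ → ℝ) : Prop where
  pos : ∀ p, 0 < V p
  equiv : SeqEquiv V W
  logConvex : IsLogConvex V
  logConcave : IsLogConcave (fun p => V p / (p.factorial : ℝ))

/-! ### Spaces of ultradifferentiable functions -/

/-- A locally convex vector space of complex-valued functions on `X`. Two such spaces are equal
iff they consist of the same functions and carry the same topology. -/
structure FunctionLCS (X : Type) where
  carrier : Submodule ℂ (X → ℂ)
  topology : TopologicalSpace carrier
  isTopologicalAddGroup : IsTopologicalAddGroup carrier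
  continuousSMul : ContinuousSMul ℂ carrier
  locallyConvexSpace : LocallyConvexSpace ℝ carrier

section Spaces

open scoped ContDiff

variable {d : ℕ}

/-- Regular compact subsets of an open set `U ⊆ ℝ^d`: compact sets on which derivatives of
functions given only on the set are unambiguous. Finite unions of closed balls of positive radius
are of this kind, so that every compact subset of `U` is contained in the interior of one of
them. -/
structure RegularCompact (U : TopologicalSpace.Opens (EuclideanSpace ℝ (Fin d))) where
  carrier : Set (EuclideanSpace ℝ (Fin d))
  isCompact : IsCompact carrier
  uniqueDiffOn : UniqueDiffOn ℝ carrier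
  subset : carrier ⊆ U

/-- Extension by zero of a function on a subset. Only derivatives within the subset are used. -/
def extendZero {S : Set (EuclideanSpace ℝ (Fin d))} (f : S → ℂ) : EuclideanSpace ℝ (Fin d) → ℂ :=
  Function.extend Subtype.val f 0

/-- The partial derivative `∂_{j 0} ⋯ ∂_{j (n-1)} f (x)` within `S`; when `j` runs through all
tuples, these are all partial derivatives `f^(α) (x)` with `|α| = n`. -/
def partialDeriv {S : Set (EuclideanSpace ℝ (Fin d))} (f : S → ℂ) (n : ℕ) (j : Fin n → Fin d)
    (x : S) : ℂ :=
  iteratedFDerivWithin ℝ n (extendZero f) S x (fun i => EuclideanSpace.single (j i) (1 : ℝ))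

/-- The family of all numbers `|f^(α) (x)| / a_{|α|}`, `x ∈ S`. -/
def weightedDeriv {S : Set (EuclideanSpace ℝ (Fin d))} (a : ℕ → ℝ) (f : S → ℂ)
    (q : Σ n : ℕ, (Fin n → Fin d) × S) : ℝ :=
  ‖partialDeriv f q.1 q.2.1 q.2.2‖ / |a q.1|

lemma extendZero_add {S : Set (EuclideanSpace ℝ (Fin d))} (f g : S → ℂ) :
    extendZero (f + g) = extendZero f + extendZero g := by
  have h := Function.extend_add (Subtype.val : S → EuclideanSpace ℝ (Fin d)) f g 0 0
  simpa [extendZero] using h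

lemma extendZero_smul {S : Set (EuclideanSpace ℝ (Fin d))} (c : ℂ) (f : S → ℂ) :
    extendZero (c • f) = c • extendZero f := by
  have h := Function.extend_smul c (Subtype.val : S → EuclideanSpace ℝ (Fin d)) f 0
  simpa [extendZero] using h

lemma extendZero_zero {S : Set (EuclideanSpace ℝ (Fin d))} :
    extendZero (0 : S → ℂ) = 0 := by
  have h := extendZero_smul (S := S) (0 : ℂ) 0
  simpa using h

lemma weightedDeriv_nonneg {S : Set (EuclideanSpace ℝ (Fin d))} (a : ℕ → ℝ) (f : S → ℂ)
    (q : Σ n : ℕ, (Fin n → Fin d) × S) : 0 ≤ weightedDeriv a f q := by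
  unfold weightedDeriv; positivity

lemma weightedDeriv_add_le {S : Set (EuclideanSpace ℝ (Fin d))} (hS : UniqueDiffOn ℝ S)
    (a : ℕ → ℝ) {f g : S → ℂ} (hf : ContDiffOn ℝ ∞ (extendZero f) S)
    (hg : ContDiffOn ℝ ∞ (extendZero g) S) (q : Σ n : ℕ, (Fin n → Fin d) × S) :
    weightedDeriv a (f + g) q ≤ weightedDeriv a f q + weightedDeriv a g q := by
  obtain ⟨n, j, x⟩ := q
  have hf' : ContDiffWithinAt ℝ n (extendZero f) S x := (hf x x.2).of_le (by exact_mod_cast le_top)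
  have hg' : ContDiffWithinAt ℝ n (extendZero g) S x := (hg x x.2).of_le (by exact_mod_cast le_top)
  simp only [weightedDeriv, partialDeriv]
  rw [extendZero_add, iteratedFDerivWithin_add_apply hf' hg' hS x.2, ← add_div]
  gcongr
  exact norm_add_le _ _

lemma weightedDeriv_smul {S : Set (EuclideanSpace ℝ (Fin d))} (hS : UniqueDiffOn ℝ S)
    (a : ℕ → ℝ) (c : ℂ) {f : S → ℂ} (hf : ContDiffOn ℝ ∞ (extendZero f) S)
    (q : Σ n : ℕ, (Fin n → Fin d) × S) :
    weightedDeriv a (c • f) q = ‖c‖ * weightedDeriv a f q := by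
  obtain ⟨n, j, x⟩ := q
  have hf' : ContDiffWithinAt ℝ n (extendZero f) S x := (hf x x.2).of_le (by exact_mod_cast le_top)
  simp only [weightedDeriv, partialDeriv]
  rw [extendZero_smul, iteratedFDerivWithin_const_smul_apply hf' hS x.2]
  simp [mul_div_assoc]

variable {U : TopologicalSpace.Opens (EuclideanSpace ℝ (Fin d))}

/-- The space of all smooth functions `f` on the regular compact set `K` with
`sup_{α, x ∈ K} |f^(α) (x)| / a_{|α|} < ∞`. -/
def stepSpace (K : RegularCompact U) (a : ℕ → ℝ) : Submodule ℂ (K.carrier → ℂ) where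
  carrier := {f | ContDiffOn ℝ ∞ (extendZero f) K.carrier ∧
    BddAbove (Set.range (weightedDeriv a f))}
  zero_mem' := by
    refine ⟨by rw [extendZero_zero]; exact contDiffOn_const, 0, ?_⟩
    rintro _ ⟨⟨n, j, x⟩, rfl⟩
    simp only [weightedDeriv, partialDeriv]
    rw [extendZero_zero]
    simp
  add_mem' := by
    rintro f g ⟨hf, C, hC⟩ ⟨hg, D, hD⟩
    refine ⟨by rw [extendZero_add]; exact hf.add hg, C + D, ?_⟩
    rintro _ ⟨q, rfl⟩
    exact (weightedDeriv_add_le K.uniqueDiffOn a hf hg q).trans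
      (add_le_add (hC ⟨q, rfl⟩) (hD ⟨q, rfl⟩))
  smul_mem' := by
    rintro c f ⟨hf, C, hC⟩
    refine ⟨by rw [extendZero_smul]; exact contDiffOn_const.smul hf, ‖c‖ * C, ?_⟩
    rintro _ ⟨q, rfl⟩
    rw [weightedDeriv_smul K.uniqueDiffOn a c hf q]
    exact mul_le_mul_of_nonneg_left (hC ⟨q, rfl⟩) (norm_nonneg c)

/-- The norm `‖f‖ = sup_{α, x ∈ K} |f^(α) (x)| / a_{|α|}`. -/
def stepNorm (K : RegularCompact U) (a : ℕ → ℝ) : Seminorm ℂ (stepSpace K a) :=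
  Seminorm.of (fun f => ⨆ q, weightedDeriv a f.1 q)
    (fun f g => by
      refine Real.iSup_le (fun q => ?_) (add_nonneg (Real.iSup_nonneg fun q =>
        weightedDeriv_nonneg a _ q) (Real.iSup_nonneg fun q => weightedDeriv_nonneg a _ q))
      exact (weightedDeriv_add_le K.uniqueDiffOn a f.2.1 g.2.1 q).trans
        (add_le_add (le_ciSup f.2.2 q) (le_ciSup g.2.2 q)))
    (fun c f => by
      rw [Real.mul_iSup_of_nonneg (norm_nonneg c)]
      exact iSup_congr fun q => weightedDeriv_smul K.uniqueDiffOn a c f.2.1 q)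

/-- The norm topology of `stepSpace K a`. -/
@[reducible]
def stepTopology (K : RegularCompact U) (a : ℕ → ℝ) : TopologicalSpace (stepSpace K a) :=
  (stepNorm K a).toSeminormedAddCommGroup.toUniformSpace.toTopologicalSpace

lemma stepTopology_isTopologicalAddGroup (K : RegularCompact U) (a : ℕ → ℝ) :
    @IsTopologicalAddGroup _ (stepTopology K a) _ := by
  exact @SeminormedAddCommGroup.toIsTopologicalAddGroup _ (stepNorm K a).toSeminormedAddCommGroup

lemma stepTopology_withSeminorms (K : RegularCompact U) (a : ℕ → ℝ) :
    @WithSeminorms ℂ _ Unit _ _ _ (fun _ => stepNorm K a) (stepTopology K a) := by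
  let _ := stepTopology K a
  have := stepTopology_isTopologicalAddGroup K a
  rw [SeminormFamily.withSeminorms_iff_topologicalSpace_eq_iInf, iInf_const]

variable {ι : Type}

/-- The union of the increasing family of spaces `stepSpace K (a i)`, formed as the linear span
of the union: if the family is directed, as is the case for all the weights considered here, then
the span is the union itself. -/
def unionSpace (K : RegularCompact U) (a : ι → ℕ → ℝ) : Submodule ℂ (K.carrier → ℂ) :=
  ⨆ i, stepSpace K (a i)

/-- The locally convex inductive limit topology: the finest locally convex vector space topology
for which all the inclusions of the normed spaces `stepSpace K (a i)` are continuous. -/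
@[reducible]
def inductiveTopology (K : RegularCompact U) (a : ι → ℕ → ℝ) :
    TopologicalSpace (unionSpace K a) :=
  sInf {t | @IsTopologicalAddGroup _ t _ ∧ @ContinuousSMul ℂ _ _ _ t ∧
    @LocallyConvexSpace ℝ _ _ _ _ _ t ∧
    ∀ i, @Continuous _ _ (stepTopology K (a i)) t
      (Submodule.inclusion (le_iSup (fun i => stepSpace K (a i)) i))}

/-- Restriction of functions from `U` to `K`. -/
def restrictTo (K : RegularCompact U) : (U → ℂ) →ₗ[ℂ] (K.carrier → ℂ) :=
  LinearMap.funLeft ℂ ℂ (Set.inclusion K.subset)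

/-- The smooth functions on the open set `U`. -/
def smoothFunctions (U : TopologicalSpace.Opens (EuclideanSpace ℝ (Fin d))) :
    Submodule ℂ (U → ℂ) where
  carrier := {f | ContDiffOn ℝ ∞ (extendZero (S := (U : Set (EuclideanSpace ℝ (Fin d)))) f)
    (U : Set (EuclideanSpace ℝ (Fin d)))}
  zero_mem' := by
    change ContDiffOn ℝ ∞ (extendZero (S := (U : Set (EuclideanSpace ℝ (Fin d)))) 0) _
    rw [extendZero_zero]; exact contDiffOn_const
  add_mem' := by
    intro f g hf hg
    change ContDiffOn ℝ ∞ (extendZero (S := (U : Set (EuclideanSpace ℝ (Fin d)))) (f + g)) _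
    rw [extendZero_add]; exact ContDiffOn.add hf hg
  smul_mem' := by
    intro c f hf
    change ContDiffOn ℝ ∞ (extendZero (S := (U : Set (EuclideanSpace ℝ (Fin d)))) (c • f)) _
    rw [extendZero_smul]; exact contDiffOn_const.smul hf

/-- The Roumieu type space: smooth `f` such that for all `K` there is `i` with
`sup_{α, x ∈ K} |f^(α) (x)| / a_i(|α|) < ∞`, with the projective limit topology over `K` of the
inductive limits over `i`. -/
def roumieuSpace (U : TopologicalSpace.Opens (EuclideanSpace ℝ (Fin d))) (a : ι → ℕ → ℝ) :
    FunctionLCS U :=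
  let E : Submodule ℂ (U → ℂ) :=
    smoothFunctions U ⊓ ⨅ K : RegularCompact U, (unionSpace K a).comap (restrictTo K)
  let r (K : RegularCompact U) : E →ₗ[ℂ] unionSpace K a :=
    (restrictTo K).restrict (fun _ hf => (Submodule.mem_iInf _).1 hf.2 K)
  { carrier := E
    topology := ⨅ K, (inductiveTopology K a).induced (r K)
    isTopologicalAddGroup := topologicalAddGroup_iInf fun K => by
      let _ := inductiveTopology K a
      have : IsTopologicalAddGroup (unionSpace K a) := topologicalAddGroup_sInf fun t ht => ht.1
      exact topologicalAddGroup_induced (r K)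
    continuousSMul := continuousSMul_iInf fun K => by
      let _ := inductiveTopology K a
      have : ContinuousSMul ℂ (unionSpace K a) := continuousSMul_sInf fun t ht => ht.2.1
      exact continuousSMul_induced (r K)
    locallyConvexSpace := LocallyConvexSpace.iInf fun K => by
      let _ := inductiveTopology K a
      have : LocallyConvexSpace ℝ (unionSpace K a) := LocallyConvexSpace.sInf fun t ht => ht.2.2.1
      exact LocallyConvexSpace.induced ((r K).restrictScalars ℝ) }

/-- The Beurling type space: smooth `f` such that `sup_{α, x ∈ K} |f^(α) (x)| / a_i(|α|) < ∞` for
all `K` and all `i`, with the topology defined by all these seminorms. -/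
def beurlingSpace (U : TopologicalSpace.Opens (EuclideanSpace ℝ (Fin d))) (a : ι → ℕ → ℝ) :
    FunctionLCS U :=
  let E : Submodule ℂ (U → ℂ) :=
    smoothFunctions U ⊓
      ⨅ q : RegularCompact U × ι, (stepSpace q.1 (a q.2)).comap (restrictTo q.1)
  let r (q : RegularCompact U × ι) : E →ₗ[ℂ] stepSpace q.1 (a q.2) :=
    (restrictTo q.1).restrict (fun _ hf => (Submodule.mem_iInf _).1 hf.2 q)
  { carrier := E
    topology := ⨅ q, (stepTopology q.1 (a q.2)).induced (r q)
    isTopologicalAddGroup := topologicalAddGroup_iInf fun q => by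
      let _ := stepTopology q.1 (a q.2)
      have := stepTopology_isTopologicalAddGroup q.1 (a q.2)
      exact topologicalAddGroup_induced (r q)
    continuousSMul := continuousSMul_iInf fun q => by
      let _ := stepTopology q.1 (a q.2)
      have := (stepTopology_withSeminorms q.1 (a q.2)).continuousSMul
      exact continuousSMul_induced (r q)
    locallyConvexSpace := LocallyConvexSpace.iInf fun q => by
      let _ := stepTopology q.1 (a q.2)
      have : LocallyConvexSpace ℝ (stepSpace q.1 (a q.2)) :=
        (stepTopology_withSeminorms q.1 (a q.2)).toLocallyConvexSpace
      exact LocallyConvexSpace.induced ((r q).restrictScalars ℝ) }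

/-- The two readings of the bracket `[·]`. -/
inductive ClassType where
  | roumieu
  | beurling

/-- The space of the given type defined by a family of sequences of weights for derivatives. -/
def ultraSpace (T : ClassType) (U : TopologicalSpace.Opens (EuclideanSpace ℝ (Fin d)))
    (a : ι → ℕ → ℝ) : FunctionLCS U :=
  match T with
  | .roumieu => roumieuSpace U a
  | .beurling => beurlingSpace U a

end Spaces

/-- `E_[M] (U)` for a sequence `M`: weights `h^p M_p` with parameter `h > 0`. -/
def spaceOfSeq {d : ℕ} (T : ClassType)
    (U : TopologicalSpace.Opens (EuclideanSpace ℝ (Fin d))) (M : ℕ → ℝ) : FunctionLCS U :=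
  ultraSpace T U (fun (h : Set.Ioi (0 : ℝ)) p => (h : ℝ) ^ p * M p)

/-- `E_[𝓜] (U)` for a matrix `𝓜 = {M^(ℓ) : ℓ > 0}`: weights `h^p M^(ℓ)_p` with parameters
`ℓ, h > 0`. -/
def spaceOfMatrix {d : ℕ} (T : ClassType)
    (U : TopologicalSpace.Opens (EuclideanSpace ℝ (Fin d))) (M : ℝ → ℕ → ℝ) : FunctionLCS U :=
  ultraSpace T U (fun (q : Set.Ioi (0 : ℝ) × Set.Ioi (0 : ℝ)) p => (q.2 : ℝ) ^ p * M q.1 p)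

/-- `E_[ω] (U)` for a weight function `ω`: weights `exp (φ* (ℓ p) / ℓ)` with parameter `ℓ > 0`. -/
def spaceOfWeight {d : ℕ} (T : ClassType)
    (U : TopologicalSpace.Opens (EuclideanSpace ℝ (Fin d))) (ω : ℝ → ℝ) : FunctionLCS U :=
  ultraSpace T U (fun (ℓ : Set.Ioi (0 : ℝ)) p => assocMatrix ω ℓ p)

/-- The conjugate matrix `{(M^(1/ℓ))* : ℓ > 0}`. -/
def conjMatrix (M : ℝ → ℕ → ℝ) (ℓ : ℝ) : ℕ → ℝ := conjSeq (M (1 / ℓ))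

end

/-! The condition on the index yields `1 < K < A` with `A ω(t) ≤ ω(K t) + C`. Iteration gives `ω(t)
≤ θ ω(D t) + C` with `θ D` as small as desired (`IsBMTWeight.exists_dilation`). This inequality is
used in two ways. Conjugation turns it into `ω*(R s) ≤ C ω*(s) + C'` for every `R`
(`IsBMTWeight.conjWeight_moderate`), so that dilations of the argument are harmless for `ω*`. The
Young conjugate turns it into `W^(ℓ)_p ≤ C h^p W^(ℓ')_p` for all `ℓ, ℓ'`
(`IsBMTWeight.assocMatrix_seqDom`), so that the weight matrix collapses to one sequence up to
geometric factors.

A space of either type depends, with its topology, only on its family of weights up to mutual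
domination (`ultraSpace_eq`). Hence every equality is reduced to a `FamilyEquiv`, with the family of
`ω*` as the common reference.

The weight functions are compared through `x^p / p!`: its supremum over `p` lies between `exp(x/2) /
3` and `exp x`. Therefore the associated function of `p! / W^(ℓ)_p` is `ω*` up to dilation and
constants (`IsBMTWeight.assocWeight_equiv_conjWeight`).

Returning from functions to sequences requires log-convexity, since only then is a sequence
determined by its associated function (`assocMatrix_assocWeight`). For this, `W^(ℓ)` is replaced by
an equivalent `V` with `V_p / p!` log-concave, so that `p! / V_p` is log-convex. Such a `V` exists
because the roots of `W^(ℓ)_p` increase while their quotients by `p` almost decrease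
(`IsBMTWeight.exists_youngConj_div_le`, `exists_regularization`). Since the family of `ω*` also
collapses to a single sequence, that sequence is equivalent to `p! / V_p` and hence to `p! /
W^(ℓ)_p`. -/

open Filter Topology

noncomputable section

/-! ### Equality of spaces by continuous inclusions -/

namespace FunctionLCS

/-- Continuous inclusion of locally convex spaces of functions. -/
def ContIncl {X : Type} (A B : FunctionLCS X) : Prop :=
  ∃ h : A.carrier ≤ B.carrier, @Continuous _ _ A.topology B.topology (Submodule.inclusion h)

lemma ContIncl.antisymm {X : Type} {A B : FunctionLCS X} (hAB : A.ContIncl B)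
    (hBA : B.ContIncl A) : A = B := by
  obtain ⟨E, t, _, _, _⟩ := A
  obtain ⟨E', t', _, _, _⟩ := B
  obtain ⟨h, hc⟩ := hAB
  obtain ⟨h', hc'⟩ := hBA
  obtain rfl : E = E' := le_antisymm h h'
  have : t = t' := le_antisymm (continuous_id_iff_le.1 hc) (continuous_id_iff_le.1 hc')
  subst this
  rfl

end FunctionLCS

/-! ### Domination between families of weights -/

section Domination

variable {ι κ : Type}

/-- Every sequence of the family `a` is dominated by a sequence of the family `b`. -/
def RoumieuLE (a : ι → ℕ → ℝ) (b : κ → ℕ → ℝ) : Prop :=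
  ∀ i, ∃ j, ∃ C : ℝ, 0 < C ∧ ∀ p, a i p ≤ C * b j p

/-- Every sequence of the family `b` dominates a sequence of the family `a`. -/
def BeurlingLE (a : ι → ℕ → ℝ) (b : κ → ℕ → ℝ) : Prop :=
  ∀ j, ∃ i, ∃ C : ℝ, 0 < C ∧ ∀ p, a i p ≤ C * b j p

/-- Families of sequences which define the same spaces. -/
structure FamilyEquiv (a : ι → ℕ → ℝ) (b : κ → ℕ → ℝ) : Prop where
  roumieu_le : RoumieuLE a b
  roumieu_ge : RoumieuLE b a
  beurling_le : BeurlingLE a b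
  beurling_ge : BeurlingLE b a

lemma RoumieuLE.trans {μ : Type} {a : ι → ℕ → ℝ} {b : κ → ℕ → ℝ} {c : μ → ℕ → ℝ}
    (h : RoumieuLE a b) (h' : RoumieuLE b c) : RoumieuLE a c := by
  intro i
  obtain ⟨j, C, hC, hj⟩ := h i
  obtain ⟨k, D, hD, hk⟩ := h' j
  refine ⟨k, C * D, by positivity, fun p => (hj p).trans ?_⟩
  rw [mul_assoc]
  exact mul_le_mul_of_nonneg_left (hk p) hC.le

lemma BeurlingLE.trans {μ : Type} {a : ι → ℕ → ℝ} {b : κ → ℕ → ℝ} {c : μ → ℕ → ℝ}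
    (h : BeurlingLE a b) (h' : BeurlingLE b c) : BeurlingLE a c := by
  intro k
  obtain ⟨j, D, hD, hk⟩ := h' k
  obtain ⟨i, C, hC, hj⟩ := h j
  refine ⟨i, C * D, by positivity, fun p => (hj p).trans ?_⟩
  rw [mul_assoc]
  exact mul_le_mul_of_nonneg_left (hk p) hC.le

lemma FamilyEquiv.symm {a : ι → ℕ → ℝ} {b : κ → ℕ → ℝ} (h : FamilyEquiv a b) :
    FamilyEquiv b a :=
  ⟨h.2, h.1, h.4, h.3⟩

lemma FamilyEquiv.trans {μ : Type} {a : ι → ℕ → ℝ} {b : κ → ℕ → ℝ} {c : μ → ℕ → ℝ}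
    (h : FamilyEquiv a b) (h' : FamilyEquiv b c) : FamilyEquiv a c :=
  ⟨h.1.trans h'.1, h'.2.trans h.2, h.3.trans h'.3, h'.4.trans h.4⟩

end Domination

/-! ### Dependence of the spaces on the family of weights -/

section SpaceInclusions

open scoped ContDiff

variable {d : ℕ} {U : TopologicalSpace.Opens (EuclideanSpace ℝ (Fin d))} {ι κ : Type}

lemma weightedDeriv_le_of_le {S : Set (EuclideanSpace ℝ (Fin d))} {a b : ℕ → ℝ}
    (ha : ∀ p, 0 < a p) {C : ℝ} (hC : 0 < C) (hab : ∀ p, a p ≤ C * b p) (f : S → ℂ)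
    (q : Σ n : ℕ, (Fin n → Fin d) × S) :
    weightedDeriv b f q ≤ C * weightedDeriv a f q := by
  unfold weightedDeriv
  have hb : 0 < b q.1 := pos_of_mul_pos_right ((ha _).trans_le (hab q.1)) hC.le
  rw [abs_of_pos hb, abs_of_pos (ha _), mul_div_assoc', div_le_div_iff₀ hb (ha _)]
  calc _ ≤ ‖partialDeriv f q.1 q.2.1 q.2.2‖ * (C * b q.1) :=
        mul_le_mul_of_nonneg_left (hab _) (norm_nonneg _)
    _ = _ := by ring

lemma stepSpace_le (K : RegularCompact U) {a b : ℕ → ℝ} (ha : ∀ p, 0 < a p) {C : ℝ} (hC : 0 < C)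
    (hab : ∀ p, a p ≤ C * b p) : stepSpace K a ≤ stepSpace K b := by
  rintro f ⟨hf, B, hB⟩
  refine ⟨hf, C * B, ?_⟩
  rintro _ ⟨q, rfl⟩
  exact (weightedDeriv_le_of_le ha hC hab f q).trans
    (mul_le_mul_of_nonneg_left (hB ⟨q, rfl⟩) hC.le)

lemma continuous_stepSpace_inclusion (K : RegularCompact U) {a b : ℕ → ℝ} (ha : ∀ p, 0 < a p)
    {C : ℝ} (hC : 0 < C) (hab : ∀ p, a p ≤ C * b p) :
    @Continuous _ _ (stepTopology K a) (stepTopology K b)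
      (Submodule.inclusion (stepSpace_le K ha hC hab)) := by
  let _ := (stepNorm K a).toSeminormedAddCommGroup
  let _ := (stepNorm K b).toSeminormedAddCommGroup
  refine AddMonoidHomClass.continuous_of_bound _ C fun f => ?_
  change (⨆ q, weightedDeriv b f.1 q) ≤ C * ⨆ q, weightedDeriv a f.1 q
  exact Real.iSup_le (fun q => (weightedDeriv_le_of_le ha hC hab f.1 q).trans
    (mul_le_mul_of_nonneg_left (le_ciSup f.2.2 q) hC.le))
    (mul_nonneg hC.le (Real.iSup_nonneg fun q => weightedDeriv_nonneg a _ q))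

lemma unionSpace_le (K : RegularCompact U) {a : ι → ℕ → ℝ} {b : κ → ℕ → ℝ}
    (ha : ∀ i p, 0 < a i p) (hab : RoumieuLE a b) : unionSpace K a ≤ unionSpace K b := by
  refine iSup_le fun i => ?_
  obtain ⟨j, C, hC, h⟩ := hab i
  exact (stepSpace_le K (ha i) hC h).trans (le_iSup (fun j => stepSpace K (b j)) j)

lemma continuous_unionSpace_inclusion (K : RegularCompact U) {a : ι → ℕ → ℝ} {b : κ → ℕ → ℝ}
    (ha : ∀ i p, 0 < a i p) (hab : RoumieuLE a b) :
    @Continuous _ _ (inductiveTopology K a) (inductiveTopology K b)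
      (Submodule.inclusion (unionSpace_le K ha hab)) := by
  refine continuous_sInf_rng.2 fun t ht => ?_
  obtain ⟨h1, h2, h3, h4⟩ := ht
  -- Universal property of the inductive limit: the pullback of an admissible topology `t` is
  -- admissible for the family `a`, hence coarser than the inductive topology.
  refine @continuous_sInf_dom _ _ _ _ _
    (t.induced (Submodule.inclusion (unionSpace_le K ha hab))) ⟨?_, ?_, ?_, ?_⟩ ?_
  · exact topologicalAddGroup_induced _
  · exact continuousSMul_induced _
  · exact LocallyConvexSpace.induced ((Submodule.inclusion (unionSpace_le K ha hab)).restrictScalars ℝ)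
  · intro i
    obtain ⟨j, C, hC, h⟩ := hab i
    let _ := stepTopology K (a i)
    let _ := stepTopology K (b j)
    exact continuous_induced_rng.2
      ((h4 j).comp (continuous_stepSpace_inclusion K (ha i) hC h))
  · exact continuous_induced_dom

/-- The projections defining the topology of the Roumieu space. -/
def roumieuRestrict (a : ι → ℕ → ℝ) (K : RegularCompact U) :
    (roumieuSpace U a).carrier → unionSpace K a :=
  fun f => ⟨restrictTo K f.1, (Submodule.mem_iInf _).1 f.2.2 K⟩

lemma roumieuSpace_topology (a : ι → ℕ → ℝ) : (roumieuSpace U a).topology =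
    ⨅ K, (inductiveTopology K a).induced (roumieuRestrict a K) := rfl

lemma roumieuSpace_carrier_le {a : ι → ℕ → ℝ} {b : κ → ℕ → ℝ} (ha : ∀ i p, 0 < a i p)
    (hab : RoumieuLE a b) : (roumieuSpace U a).carrier ≤ (roumieuSpace U b).carrier :=
  inf_le_inf_left _ (iInf_mono fun K => Submodule.comap_mono (unionSpace_le K ha hab))

lemma continuous_roumieuRestrict (a : ι → ℕ → ℝ) (K : RegularCompact U) :
    @Continuous _ _ (roumieuSpace U a).topology (inductiveTopology K a) (roumieuRestrict a K) := by
  rw [continuous_iff_le_induced, roumieuSpace_topology a]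
  exact iInf_le _ K

lemma coe_roumieuRestrict (a : ι → ℕ → ℝ) (K : RegularCompact U)
    (f : (roumieuSpace U a).carrier) :
    (roumieuRestrict a K f : K.carrier → ℂ) = restrictTo K (f : U → ℂ) := rfl

lemma roumieuRestrict_comp_inclusion {a : ι → ℕ → ℝ} {b : κ → ℕ → ℝ} (ha : ∀ i p, 0 < a i p)
    (hab : RoumieuLE a b) (K : RegularCompact U) :
    roumieuRestrict b K ∘ Submodule.inclusion (roumieuSpace_carrier_le ha hab) =
      Submodule.inclusion (unionSpace_le K ha hab) ∘ roumieuRestrict a K := by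
  funext f
  apply Subtype.ext
  rw [Function.comp_apply, Function.comp_apply, coe_roumieuRestrict, Submodule.coe_inclusion,
    Submodule.coe_inclusion, coe_roumieuRestrict]

lemma roumieuSpace_contIncl {a : ι → ℕ → ℝ} {b : κ → ℕ → ℝ} (ha : ∀ i p, 0 < a i p)
    (hab : RoumieuLE a b) : (roumieuSpace U a).ContIncl (roumieuSpace U b) := by
  refine ⟨roumieuSpace_carrier_le ha hab, ?_⟩
  rw [roumieuSpace_topology b]
  refine continuous_iInf_rng.2 fun K => continuous_induced_rng.2 ?_
  rw [roumieuRestrict_comp_inclusion ha hab K]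
  exact @Continuous.comp _ _ _ (roumieuSpace U a).topology (inductiveTopology K a)
    (inductiveTopology K b) _ _ (continuous_unionSpace_inclusion K ha hab)
    (continuous_roumieuRestrict a K)

/-- The projections defining the topology of the Beurling space. -/
def beurlingRestrict (a : ι → ℕ → ℝ) (q : RegularCompact U × ι) :
    (beurlingSpace U a).carrier → stepSpace q.1 (a q.2) :=
  fun f => ⟨restrictTo q.1 f.1, (Submodule.mem_iInf _).1 f.2.2 q⟩

lemma beurlingSpace_topology (a : ι → ℕ → ℝ) : (beurlingSpace U a).topology =
    ⨅ q : RegularCompact U × ι,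
      (stepTopology q.1 (a q.2)).induced (beurlingRestrict a q) := rfl

lemma beurlingSpace_carrier_le {a : ι → ℕ → ℝ} {b : κ → ℕ → ℝ} (ha : ∀ i p, 0 < a i p)
    (hab : BeurlingLE a b) : (beurlingSpace U a).carrier ≤ (beurlingSpace U b).carrier := by
  choose i C hC h using hab
  exact inf_le_inf_left _ (le_iInf fun q => (iInf_le _ (q.1, i q.2)).trans
    (Submodule.comap_mono (stepSpace_le q.1 (ha _) (hC q.2) (h q.2))))

lemma beurlingSpace_contIncl {a : ι → ℕ → ℝ} {b : κ → ℕ → ℝ} (ha : ∀ i p, 0 < a i p)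
    (hab : BeurlingLE a b) : (beurlingSpace U a).ContIncl (beurlingSpace U b) := by
  refine ⟨beurlingSpace_carrier_le ha hab, ?_⟩
  rw [beurlingSpace_topology b]
  refine continuous_iInf_rng.2 fun q => continuous_induced_rng.2 ?_
  obtain ⟨i, C, hC, h⟩ := hab q.2
  have hr : @Continuous _ _ (beurlingSpace U a).topology (stepTopology q.1 (a i))
      (beurlingRestrict a (q.1, i)) := by
    rw [beurlingSpace_topology a]
    exact continuous_iInf_dom (i := (q.1, i)) continuous_induced_dom
  have hcomp : beurlingRestrict b q ∘ Submodule.inclusion (beurlingSpace_carrier_le ha hab) =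
      Submodule.inclusion (stepSpace_le q.1 (ha i) hC h) ∘ beurlingRestrict a (q.1, i) := rfl
  rw [hcomp]
  exact @Continuous.comp _ _ _ (beurlingSpace U a).topology (stepTopology q.1 (a i))
    (stepTopology q.1 (b q.2)) _ _ (continuous_stepSpace_inclusion q.1 (ha i) hC h) hr

lemma ultraSpace_eq {a : ι → ℕ → ℝ} {b : κ → ℕ → ℝ} (ha : ∀ i p, 0 < a i p)
    (hb : ∀ j p, 0 < b j p) (hab : FamilyEquiv a b) (T : ClassType) :
    ultraSpace T U a = ultraSpace T U b := by
  cases T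
  · exact (roumieuSpace_contIncl ha hab.1).antisymm (roumieuSpace_contIncl hb hab.2)
  · exact (beurlingSpace_contIncl ha hab.3).antisymm (beurlingSpace_contIncl hb hab.4)

end SpaceInclusions

/-! ### Young conjugates and weight matrices -/

section WeightFunctions

variable {σ τ ω : ℝ → ℝ}

/-- The relation `σ = O(τ)`, in a form valid on all of `[0,∞)`. -/
def WeightLE (σ τ : ℝ → ℝ) : Prop :=
  ∃ C : ℝ, 0 < C ∧ ∃ C' : ℝ, ∀ t, 0 ≤ t → σ t ≤ C * τ t + C'

/-- Nonnegative functions with finite Young conjugate. -/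
structure HasYoungConj (σ : ℝ → ℝ) : Prop where
  nonneg : ∀ t, 0 ≤ t → 0 ≤ σ t
  bddAbove : ∀ x, 0 ≤ x → BddAbove ((fun y : ℝ => x * y - σ (Real.exp y)) '' Set.Ici 0)

lemma HasYoungConj.le (hσ : HasYoungConj σ) {x y : ℝ} (hx : 0 ≤ x) (hy : 0 ≤ y) :
    x * y - σ (Real.exp y) ≤ youngConj σ x :=
  le_csSup (hσ.bddAbove x hx) ⟨y, hy, rfl⟩

lemma youngConj_le {x B : ℝ} (h : ∀ y, 0 ≤ y → x * y - σ (Real.exp y) ≤ B) :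
    youngConj σ x ≤ B := by
  refine csSup_le (Set.nonempty_Ici.image _) ?_
  rintro _ ⟨y, hy, rfl⟩
  exact h y hy

lemma HasYoungConj.le_of_dilation (hσ : HasYoungConj σ) {C C' D : ℝ} (hC : 0 < C) (hD : 0 < D)
    (h : ∀ t, 0 ≤ t → σ (D * t) ≤ C * τ t + C') {x : ℝ} (hx : 0 ≤ x) (y : ℝ) :
    x * y - τ (Real.exp y) ≤ (youngConj σ (C * x) + C' + σ 1) / C - x * Real.log D := by
  have h1 := h _ (Real.exp_pos y).le
  have h2 : D * Real.exp y = Real.exp (y + Real.log D) := by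
    rw [Real.exp_add, Real.exp_log hD, mul_comm]
  have h0 : 0 ≤ σ 1 := hσ.nonneg 1 zero_le_one
  rw [le_sub_iff_add_le, le_div_iff₀ hC]
  -- The Young conjugate only tests nonnegative arguments. If `y + log D` is negative, the test
  -- point `0` replaces it, which costs the term `σ 1`.
  rcases le_total 0 (y + Real.log D) with hz | hz
  · have h3 := hσ.le (x := C * x) (by positivity) hz
    rw [← h2] at h3
    nlinarith
  · have h3 := hσ.le (x := C * x) (by positivity) le_rfl
    rw [mul_zero, Real.exp_zero] at h3
    have h4 := hσ.nonneg (D * Real.exp y) (by positivity)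
    have h5 : C * x * (y + Real.log D) ≤ 0 :=
      mul_nonpos_of_nonneg_of_nonpos (by positivity) hz
    nlinarith

lemma HasYoungConj.youngConj_dilation (hσ : HasYoungConj σ) {C C' D : ℝ} (hC : 0 < C)
    (hD : 0 < D) (h : ∀ t, 0 ≤ t → σ (D * t) ≤ C * τ t + C') {x : ℝ} (hx : 0 ≤ x) :
    youngConj τ x ≤ (youngConj σ (C * x) + C' + σ 1) / C - x * Real.log D :=
  youngConj_le fun y _ => hσ.le_of_dilation hC hD h hx y

lemma HasYoungConj.of_weightLE (hσ : HasYoungConj σ) (hτ : ∀ t, 0 ≤ t → 0 ≤ τ t)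
    (h : WeightLE σ τ) : HasYoungConj τ := by
  obtain ⟨C, hC, C', h⟩ := h
  refine ⟨hτ, fun x hx => ⟨(youngConj σ (C * x) + C' + σ 1) / C - x * Real.log 1, ?_⟩⟩
  rintro _ ⟨y, -, rfl⟩
  exact hσ.le_of_dilation hC one_pos (fun t ht => by rw [one_mul]; exact h t ht) hx y

lemma assocMatrix_pos (σ : ℝ → ℝ) (ℓ : ℝ) (p : ℕ) : 0 < assocMatrix σ ℓ p := Real.exp_pos _

/-- Dilating the argument of a weight by `D` shifts the logarithmic variable by `log D`, which
appears as the geometric factor `D ^ p`; a constant factor `C` moves the matrix parameter. All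
exchanges between `h ^ p` and `ℓ` rest on this. -/
lemma HasYoungConj.assocMatrix_dilation (hσ : HasYoungConj σ) {C C' D : ℝ} (hC : 0 < C)
    (hD : 0 < D) (h : ∀ t, 0 ≤ t → σ (D * t) ≤ C * τ t + C') {ℓ : ℝ} (hℓ : 0 < ℓ) :
    ∃ c : ℝ, 0 < c ∧ ∀ p, D ^ p * assocMatrix τ ℓ p ≤ c * assocMatrix σ (C * ℓ) p := by
  refine ⟨Real.exp ((C' + σ 1) / (C * ℓ)), Real.exp_pos _, fun p => ?_⟩
  have h1 := hσ.youngConj_dilation hC hD h (x := ℓ * p) (by positivity)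
  have h2 : D ^ p = Real.exp (p * Real.log D) := by
    rw [← Real.log_pow, Real.exp_log (by positivity)]
  rw [assocMatrix, assocMatrix, h2, ← Real.exp_add, ← Real.exp_add, Real.exp_le_exp]
  have h3 : 1 / ℓ * youngConj τ (ℓ * p) ≤
      1 / ℓ * ((youngConj σ (C * (ℓ * p)) + C' + σ 1) / C - ℓ * p * Real.log D) :=
    mul_le_mul_of_nonneg_left h1 (by positivity)
  have h4 : 1 / ℓ * ((youngConj σ (C * (ℓ * p)) + C' + σ 1) / C - ℓ * p * Real.log D) =
      (C' + σ 1) / (C * ℓ) + 1 / (C * ℓ) * youngConj σ (C * ℓ * p) - p * Real.log D := by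
    rw [← mul_assoc C ℓ]
    field_simp
    ring
  linarith

lemma HasYoungConj.assocMatrix_le (hσ : HasYoungConj σ) {C C' : ℝ} (hC : 0 < C)
    (h : ∀ t, 0 ≤ t → σ t ≤ C * τ t + C') {ℓ : ℝ} (hℓ : 0 < ℓ) :
    ∃ c : ℝ, 0 < c ∧ ∀ p, assocMatrix τ ℓ p ≤ c * assocMatrix σ (C * ℓ) p := by
  obtain ⟨c, hc, h'⟩ := hσ.assocMatrix_dilation hC one_pos
    (fun t ht => by rw [one_mul]; exact h t ht) hℓ
  exact ⟨c, hc, fun p => by simpa using h' p⟩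

lemma HasYoungConj.assocMatrix_mono (hσ : HasYoungConj σ) {ℓ ℓ' : ℝ} (hℓ : 0 < ℓ)
    (h : ℓ ≤ ℓ') : ∃ c : ℝ, 0 < c ∧ ∀ p, assocMatrix σ ℓ p ≤ c * assocMatrix σ ℓ' p := by
  obtain ⟨c, hc, h'⟩ := hσ.assocMatrix_le (τ := σ) (C := ℓ' / ℓ) (C' := 0)
    (div_pos (hℓ.trans_le h) hℓ) (fun t ht => by
      rw [add_zero]
      exact le_mul_of_one_le_left (hσ.nonneg t ht) ((one_le_div hℓ).2 h)) hℓ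
  rw [div_mul_cancel₀ _ hℓ.ne'] at h'
  exact ⟨c, hc, h'⟩

/-- The family of weights defining the space of a weight function. -/
def weightFamily (σ : ℝ → ℝ) : Set.Ioi (0 : ℝ) → ℕ → ℝ := fun ℓ p => assocMatrix σ ℓ p

lemma weightFamily_equiv (hσ : HasYoungConj σ) (hτ : HasYoungConj τ) (h : WeightLE σ τ)
    (h' : WeightLE τ σ) : FamilyEquiv (weightFamily σ) (weightFamily τ) := by
  obtain ⟨C, hC, C', h⟩ := h
  obtain ⟨D, hD, D', h'⟩ := h'
  refine ⟨fun ℓ => ?_, fun ℓ => ?_, fun ℓ => ?_, fun ℓ => ?_⟩ <;> obtain ⟨ℓ, hℓ⟩ := ℓ <;>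
    have hℓ' : 0 < ℓ := hℓ
  · exact ⟨⟨D * ℓ, mul_pos hD hℓ⟩, hτ.assocMatrix_le hD h' hℓ⟩
  · exact ⟨⟨C * ℓ, mul_pos hC hℓ⟩, hσ.assocMatrix_le hC h hℓ⟩
  · refine ⟨⟨ℓ / D, div_pos hℓ' hD⟩, ?_⟩
    have := hτ.assocMatrix_le hD h' (div_pos hℓ' hD)
    rwa [mul_div_cancel₀ _ hD.ne'] at this
  · refine ⟨⟨ℓ / C, div_pos hℓ' hC⟩, ?_⟩
    have := hσ.assocMatrix_le hC h (div_pos hℓ' hC)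
    rwa [mul_div_cancel₀ _ hC.ne'] at this

/-! ### Conjugate weight functions -/

/-- Functions with finite conjugate. -/
def HasConj (σ : ℝ → ℝ) : Prop :=
  ∀ s, 0 ≤ s → BddAbove ((fun t : ℝ => s * t - σ t) '' Set.Ici 0)

lemma HasConj.le (hσ : HasConj σ) {s t : ℝ} (hs : 0 ≤ s) (ht : 0 ≤ t) :
    s * t - σ t ≤ conjWeight σ s :=
  le_csSup (hσ s hs) ⟨t, ht, rfl⟩

lemma conjWeight_le {s B : ℝ} (h : ∀ t, 0 ≤ t → s * t - σ t ≤ B) : conjWeight σ s ≤ B := by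
  refine csSup_le (Set.nonempty_Ici.image _) ?_
  rintro _ ⟨y, hy, rfl⟩
  exact h y hy

lemma HasConj.le_of_le (hσ : HasConj σ) {C C' : ℝ} (hC : 0 < C)
    (h : ∀ t, 0 ≤ t → σ t ≤ C * τ t + C') {s t : ℝ} (hs : 0 ≤ s) (ht : 0 ≤ t) :
    s * t - τ t ≤ (conjWeight σ (C * s) + C') / C := by
  have h1 := hσ.le (s := C * s) (by positivity) ht
  have h2 := h t ht
  rw [le_div_iff₀ hC]
  nlinarith

lemma HasConj.of_weightLE (hσ : HasConj σ) (h : WeightLE σ τ) : HasConj τ := by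
  obtain ⟨C, hC, C', h⟩ := h
  refine fun s hs => ⟨(conjWeight σ (C * s) + C') / C, ?_⟩
  rintro _ ⟨y, hy, rfl⟩
  exact hσ.le_of_le hC h hs hy

lemma HasConj.conjWeight_le_of_le (hσ : HasConj σ) {C C' : ℝ} (hC : 0 < C)
    (h : ∀ t, 0 ≤ t → σ t ≤ C * τ t + C') {s : ℝ} (hs : 0 ≤ s) :
    conjWeight τ s ≤ (conjWeight σ (C * s) + C') / C :=
  conjWeight_le fun _ ht => hσ.le_of_le hC h hs ht

lemma HasConj.conjWeight_nonneg (hσ : HasConj σ) (h0 : σ 0 = 0) {s : ℝ} (hs : 0 ≤ s) :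
    0 ≤ conjWeight σ s := by
  simpa [h0] using hσ.le hs le_rfl

/-- Holds because `θ σ ≤ σ` for nonnegative `σ`. It is the converse of moderate growth needed to
trade the matrix parameter of `ω*` for a geometric factor. -/
lemma HasConj.conjWeight_mul_le (hσ : HasConj σ) (hn : ∀ t, 0 ≤ t → 0 ≤ σ t) {θ s : ℝ}
    (hθ : 0 ≤ θ) (hθ1 : θ ≤ 1) (hs : 0 ≤ s) : conjWeight σ (θ * s) ≤ θ * conjWeight σ s := by
  refine conjWeight_le fun t ht => ?_
  have h1 := mul_le_mul_of_nonneg_left (hσ.le hs ht) hθ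
  have h2 := mul_le_mul_of_nonneg_right hθ1 (hn t ht)
  nlinarith

/-! ### Braun-Meise-Taylor weight functions -/

namespace IsBMTWeight

lemma nonneg (hω : IsBMTWeight ω) (t : ℝ) (ht : 0 ≤ t) : 0 ≤ ω t := by
  have := hω.monotoneOn (Set.mem_Ici.2 le_rfl) (Set.mem_Ici.2 ht) ht
  rwa [hω.eq_zero 0 (by simp)] at this

lemma map_zero (hω : IsBMTWeight ω) : ω 0 = 0 := hω.eq_zero 0 (by simp)

lemma map_one (hω : IsBMTWeight ω) : ω 1 = 0 := hω.eq_zero 1 (by simp)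

lemma log_le (hω : IsBMTWeight ω) {ε : ℝ} (hε : 0 < ε) :
    ∃ B : ℝ, 0 ≤ B ∧ ∀ t, 1 ≤ t → Real.log t ≤ ε * ω t + B := by
  obtain ⟨T, hT⟩ := eventually_atTop.1 (hω.log_isLittleO.bound hε)
  refine ⟨Real.log (max T 1), Real.log_nonneg (le_max_right _ _), fun t ht => ?_⟩
  have hn := hω.nonneg t (by linarith)
  rcases le_total T t with h | h
  · have := hT t h
    rw [Real.norm_of_nonneg (Real.log_nonneg ht), Real.norm_of_nonneg hn] at this
    linarith [Real.log_nonneg (le_max_right T 1)]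
  · have := Real.log_le_log (by linarith) (h.trans (le_max_left T 1))
    nlinarith

lemma self_le (hω : IsBMTWeight ω) (hC : (fun t : ℝ => t) =o[atTop] ω) {ε : ℝ} (hε : 0 < ε) :
    ∃ B : ℝ, 0 ≤ B ∧ ∀ t, 0 ≤ t → t ≤ ε * ω t + B := by
  obtain ⟨T, hT⟩ := eventually_atTop.1 (hC.bound hε)
  refine ⟨max T 0, le_max_right _ _, fun t ht => ?_⟩
  have hn := hω.nonneg t ht
  rcases le_total T t with h | h
  · have := hT t h
    rw [Real.norm_of_nonneg ht, Real.norm_of_nonneg hn] at this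
    linarith [le_max_right T 0]
  · have := h.trans (le_max_left T 0)
    nlinarith

lemma hasYoungConj (hω : IsBMTWeight ω) : HasYoungConj ω := by
  refine ⟨hω.nonneg, fun x hx => ?_⟩
  obtain ⟨B, hB, h⟩ := hω.log_le (ε := 1 / (x + 1)) (by positivity)
  refine ⟨(x + 1) * B, ?_⟩
  rintro _ ⟨y, hy, rfl⟩
  have hy' : 0 ≤ y := hy
  have h1 := h (Real.exp y) (Real.one_le_exp hy)
  rw [Real.log_exp, one_div, inv_mul_eq_div, ← sub_le_iff_le_add, le_div_iff₀ (by positivity)] at h1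
  change x * y - ω (Real.exp y) ≤ _
  nlinarith

lemma hasConj (hω : IsBMTWeight ω) (hC : (fun t : ℝ => t) =o[atTop] ω) : HasConj ω := by
  intro s hs
  obtain ⟨B, hB, h⟩ := hω.self_le hC (ε := 1 / (s + 1)) (by positivity)
  refine ⟨(s + 1) * B, ?_⟩
  rintro _ ⟨t, ht, rfl⟩
  have ht' : 0 ≤ t := ht
  have h1 := h t ht
  rw [one_div, inv_mul_eq_div, ← sub_le_iff_le_add, le_div_iff₀ (by positivity)] at h1
  change s * t - ω t ≤ _
  nlinarith

/-- The constants are `K = A ^ γ`, which is below `A` because some admissible `γ` is below `1`; the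
additive `C` covers the bounded range of `t` where the lower limit gives nothing. -/
lemma exists_growth (hω : IsBMTWeight ω) (hγ : upperIndex ω < 1) :
    ∃ K A C : ℝ, 1 < K ∧ K < A ∧ 0 ≤ C ∧ ∀ t, 0 ≤ t → A * ω t ≤ ω (K * t) + C := by
  simp only [upperIndex, iInf_lt_iff] at hγ
  obtain ⟨γ, ⟨hγ0, A, hA, hlim⟩, hγ1⟩ := hγ
  have hγ1' : γ < 1 := by exact_mod_cast hγ1
  have hK : 1 < A ^ γ := Real.one_lt_rpow hA hγ0
  have h1 := eventually_lt_of_lt_liminf hlim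
  have h2 := hω.tendsto_atTop.eventually_gt_atTop 0
  obtain ⟨T, hT⟩ := eventually_atTop.1 (h1.and h2)
  refine ⟨A ^ γ, A, A * ω (max T 0), hK, ?_, ?_, fun t ht => ?_⟩
  · simpa using Real.rpow_lt_rpow_of_exponent_lt hA hγ1'
  · exact mul_nonneg (by linarith) (hω.nonneg _ (le_max_right _ _))
  · have hn := hω.nonneg (max T 0) (le_max_right _ _)
    have hn' := hω.nonneg (A ^ γ * t) (by positivity)
    rcases le_total T t with h | h
    · obtain ⟨h3, h4⟩ := hT t h
      rw [EReal.coe_lt_coe_iff, lt_div_iff₀ h4] at h3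
      nlinarith
    · have := hω.monotoneOn (Set.mem_Ici.2 ht) (Set.mem_Ici.2 (le_max_right T 0))
        (h.trans (le_max_left T 0))
      nlinarith

/-- Iterating the growth inequality `n` times gives `θ = A ^ (-n)` and `D = K ^ n`, and `θ D = (K /
A) ^ n` falls below `1 / R` for large `n`. -/
lemma exists_dilation (hω : IsBMTWeight ω) (hγ : upperIndex ω < 1) {R : ℝ} (hR : 0 < R) :
    ∃ θ D C : ℝ, 0 < θ ∧ 1 ≤ D ∧ θ * D * R ≤ 1 ∧ ∀ t, 0 ≤ t → ω t ≤ θ * ω (D * t) + C := by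
  obtain ⟨K, A, C, hK, hKA, hC, h⟩ := hω.exists_growth hγ
  have hA : 0 < A := by linarith
  have key : ∀ n : ℕ, ∃ C : ℝ, ∀ t, 0 ≤ t → ω t ≤ (A ^ n)⁻¹ * ω (K ^ n * t) + C := by
    intro n
    induction n with
    | zero => exact ⟨0, fun t _ => by simp⟩
    | succ n ih =>
      obtain ⟨B, hB⟩ := ih
      refine ⟨B + (A ^ (n + 1))⁻¹ * C, fun t ht => (hB t ht).trans ?_⟩
      have h1 := mul_le_mul_of_nonneg_left (h (K ^ n * t) (by positivity))
        (show 0 ≤ (A ^ (n + 1))⁻¹ by positivity)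
      have h2 : (A ^ (n + 1))⁻¹ * (A * ω (K ^ n * t)) = (A ^ n)⁻¹ * ω (K ^ n * t) := by
        rw [pow_succ]; field_simp
      rw [h2, ← mul_assoc, ← pow_succ'] at h1
      linarith
  obtain ⟨n, hn⟩ := exists_pow_lt_of_lt_one (inv_pos.2 hR) ((div_lt_one hA).2 hKA)
  obtain ⟨B, hB⟩ := key n
  refine ⟨(A ^ n)⁻¹, K ^ n, B, by positivity, one_le_pow₀ hK.le, ?_, hB⟩
  rw [div_pow, lt_inv_comm₀ (by positivity) hR] at hn
  have h3 : (A ^ n)⁻¹ * K ^ n * R ≤ (K ^ n / A ^ n) * (K ^ n / A ^ n)⁻¹ := by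
    rw [inv_mul_eq_div]
    gcongr
  rwa [mul_inv_cancel₀ (by positivity)] at h3

lemma conjWeight_nonneg (hω : IsBMTWeight ω) (hC : (fun t : ℝ => t) =o[atTop] ω) (s : ℝ)
    (hs : 0 ≤ s) : 0 ≤ conjWeight ω s :=
  (hω.hasConj hC).conjWeight_nonneg hω.map_zero hs

/-- Evaluating the supremum for `ω* s` at `t / D` bounds `s t / D - ω (t / D)`. Multiplication by
`θ⁻¹` turns this into a bound for `R s t - ω t`, as `R ≤ (θ D)⁻¹`. -/
lemma conjWeight_moderate (hω : IsBMTWeight ω) (hC : (fun t : ℝ => t) =o[atTop] ω)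
    (hγ : upperIndex ω < 1) {R : ℝ} (hR : 0 < R) :
    ∃ C : ℝ, 0 < C ∧ ∃ C' : ℝ, ∀ s, 0 ≤ s → conjWeight ω (R * s) ≤ C * conjWeight ω s + C' := by
  obtain ⟨θ, D, B, hθ, hD, hθD, h⟩ := hω.exists_dilation hγ hR
  have hD0 : 0 < D := by linarith
  refine ⟨θ⁻¹, by positivity, θ⁻¹ * B, fun s hs => conjWeight_le fun t ht => ?_⟩
  have h1 := h (t / D) (by positivity)
  rw [mul_div_cancel₀ _ hD0.ne'] at h1
  have h2 := (hω.hasConj hC).le (s := s) (t := t / D) hs (by positivity)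
  have h3 : θ * (R * s * t) ≤ s * (t / D) := by
    rw [mul_div_assoc', le_div_iff₀ hD0]
    nlinarith [mul_nonneg hs ht]
  rw [← mul_add, inv_mul_eq_div, le_div_iff₀ hθ]
  nlinarith

lemma hasYoungConj_conjWeight (hω : IsBMTWeight ω) (hC : (fun t : ℝ => t) =o[atTop] ω) :
    HasYoungConj (conjWeight ω) := by
  refine ⟨hω.conjWeight_nonneg hC, fun x hx => ⟨x ^ 2 / 2, ?_⟩⟩
  rintro _ ⟨y, hy, rfl⟩
  -- Testing at `t = 1`, where `ω` vanishes, gives `ω* s ≥ s`. Then `exp y ≥ y² / 2` bounds the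
  -- Young supremum by `x² / 2`.
  have h1 := (hω.hasConj hC).le (Real.exp_pos y).le zero_le_one
  rw [hω.map_one] at h1
  have h2 := Real.quadratic_le_exp_of_nonneg (Set.mem_Ici.1 hy)
  have hy' : 0 ≤ y := hy
  change x * y - conjWeight ω (Real.exp y) ≤ _
  nlinarith [sq_nonneg (x - y)]

end IsBMTWeight

end WeightFunctions

section AssociatedWeights

variable {ω : ℝ → ℝ} {M N : ℕ → ℝ}

/-! ### Comparison of sequences -/

/-- The relation `M_p ≤ C h^p N_p`. -/
def SeqDom (M N : ℕ → ℝ) : Prop :=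
  ∃ C h : ℝ, 0 < C ∧ 0 < h ∧ ∀ p, M p ≤ C * h ^ p * N p

lemma SeqDom.refl (M : ℕ → ℝ) : SeqDom M M := ⟨1, 1, one_pos, one_pos, by simp⟩

lemma SeqDom.trans {L : ℕ → ℝ} (h : SeqDom L M) (h' : SeqDom M N) : SeqDom L N := by
  obtain ⟨C, a, hC, ha, h⟩ := h
  obtain ⟨D, b, hD, hb, h'⟩ := h'
  refine ⟨C * D, a * b, by positivity, by positivity, fun p => (h p).trans ?_⟩
  calc C * a ^ p * M p ≤ C * a ^ p * (D * b ^ p * N p) :=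
        mul_le_mul_of_nonneg_left (h' p) (by positivity)
    _ = _ := by rw [mul_pow]; ring

lemma SeqLE.seqDom (hM : ∀ p, 0 < M p) (hN : ∀ p, 0 < N p) (h : SeqLE M N) : SeqDom M N := by
  obtain ⟨B, hB⟩ := h
  -- `SeqLE` says nothing about `p = 0`; the constant in front takes care of that index.
  have hC : 0 < max (M 0 / N 0) 1 := lt_max_of_lt_right one_pos
  refine ⟨max (M 0 / N 0) 1, max B 1, hC, lt_max_of_lt_right one_pos, fun p => ?_⟩
  rw [← div_le_iff₀ (hN p)]
  rcases Nat.eq_zero_or_pos p with rfl | hp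
  · simp
  · have h1 := (hB ⟨p, hp, rfl⟩).trans (le_max_left B 1)
    have h0 : 0 ≤ M p / N p := (div_pos (hM p) (hN p)).le
    have h2 := pow_le_pow_left₀ (Real.rpow_nonneg h0 _) h1 p
    rw [one_div, Real.rpow_inv_natCast_pow h0 hp.ne'] at h2
    exact h2.trans (le_mul_of_one_le_left (by positivity) (le_max_right _ _))

lemma SeqLE.of_le (hM : ∀ p, 0 < M p) (hN : ∀ p, 0 < N p) {h : ℝ} (hh : 0 < h)
    (hMN : ∀ p, 1 ≤ p → M p ≤ h ^ p * N p) : SeqLE M N := by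
  refine ⟨h, ?_⟩
  rintro _ ⟨p, hp, rfl⟩
  have hp' : p ≠ 0 := by have : 1 ≤ p := hp; omega
  have h0 : 0 ≤ M p / N p := (div_pos (hM p) (hN p)).le
  change (M p / N p) ^ (1 / (p : ℝ)) ≤ h
  rw [one_div, Real.rpow_inv_le_iff_of_pos h0 hh.le (by positivity), Real.rpow_natCast,
    div_le_iff₀ (hN p)]
  exact hMN p hp

lemma conjSeq_pos (hM : ∀ p, 0 < M p) (p : ℕ) : 0 < conjSeq M p :=
  div_pos (by positivity) (hM p)

lemma SeqDom.conjSeq (hM : ∀ p, 0 < M p) (hN : ∀ p, 0 < N p) (h : SeqDom M N) :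
    SeqDom (conjSeq N) (conjSeq M) := by
  obtain ⟨C, a, hC, ha, h⟩ := h
  refine ⟨C, a, hC, ha, fun p => ?_⟩
  unfold _root_.conjSeq
  rw [mul_div_assoc', div_le_div_iff₀ (hN p) (hM p)]
  calc _ ≤ (p.factorial : ℝ) * (C * a ^ p * N p) :=
        mul_le_mul_of_nonneg_left (h p) (by positivity)
    _ = _ := by ring

/-- The family of weights defining the space of a sequence. -/
def seqFamily (M : ℕ → ℝ) : Set.Ioi (0 : ℝ) → ℕ → ℝ := fun h p => (h : ℝ) ^ p * M p

/-- The family of weights defining the space of a matrix. -/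
def matrixFamily (M : ℝ → ℕ → ℝ) : Set.Ioi (0 : ℝ) × Set.Ioi (0 : ℝ) → ℕ → ℝ :=
  fun q p => (q.2 : ℝ) ^ p * M q.1 p

lemma SeqDom.exists_le (h : SeqDom M N) : ∃ a : ℝ, 0 < a ∧ ∀ b : ℝ, 0 < b →
    ∃ C : ℝ, 0 < C ∧ ∀ p, b ^ p * M p ≤ C * ((b * a) ^ p * N p) := by
  obtain ⟨C, a, hC, ha, h⟩ := h
  refine ⟨a, ha, fun b hb => ⟨C, hC, fun p => ?_⟩⟩
  calc b ^ p * M p ≤ b ^ p * (C * a ^ p * N p) := mul_le_mul_of_nonneg_left (h p) (by positivity)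
    _ = _ := by rw [mul_pow]; ring

lemma matrixFamily_equiv {M : ℝ → ℕ → ℝ} (h : ∀ ℓ, 0 < ℓ → SeqDom (M ℓ) N)
    (h' : ∀ ℓ, 0 < ℓ → SeqDom N (M ℓ)) : FamilyEquiv (matrixFamily M) (seqFamily N) := by
  refine ⟨fun q => ?_, fun b => ?_, fun b => ?_, fun q => ?_⟩
  · obtain ⟨a, ha, H⟩ := (h q.1 q.1.2).exists_le
    exact ⟨⟨q.2 * a, mul_pos q.2.2 ha⟩, H q.2 q.2.2⟩
  · obtain ⟨a, ha, H⟩ := (h' 1 one_pos).exists_le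
    exact ⟨(⟨1, Set.mem_Ioi.2 one_pos⟩, ⟨b * a, mul_pos b.2 ha⟩), H b b.2⟩
  · obtain ⟨a, ha, H⟩ := (h 1 one_pos).exists_le
    have hb : (0 : ℝ) < b := b.2
    refine ⟨(⟨1, Set.mem_Ioi.2 one_pos⟩, ⟨b / a, div_pos hb ha⟩), ?_⟩
    have := H (b / a) (div_pos hb ha)
    rwa [div_mul_cancel₀ _ ha.ne'] at this
  · obtain ⟨a, ha, H⟩ := (h' q.1 q.1.2).exists_le
    have hb : (0 : ℝ) < q.2 := q.2.2
    refine ⟨⟨q.2 / a, div_pos hb ha⟩, ?_⟩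
    have := H (q.2 / a) (div_pos hb ha)
    rwa [div_mul_cancel₀ _ ha.ne'] at this

lemma seqFamily_equiv (h : SeqDom M N) (h' : SeqDom N M) :
    FamilyEquiv (seqFamily M) (seqFamily N) :=
  (matrixFamily_equiv (M := fun _ => M) (N := M) (fun _ _ => .refl _) fun _ _ => .refl _).symm.trans
    (matrixFamily_equiv (fun _ _ => h) fun _ _ => h')

/-! ### Associated weight functions -/

/-- Sequences with finite associated weight function. -/
def HasAssocWeight (M : ℕ → ℝ) : Prop :=
  ∀ t, 0 ≤ t → BddAbove (Set.range fun p : ℕ => Real.log (M 0 * t ^ p / M p))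

lemma HasAssocWeight.le (hM : HasAssocWeight M) {t : ℝ} (ht : 0 ≤ t) (p : ℕ) :
    Real.log (M 0 * t ^ p / M p) ≤ assocWeight M t :=
  le_ciSup (hM t ht) p

lemma assocWeight_term_zero (hM : ∀ p, 0 < M p) (p : ℕ) :
    Real.log (M 0 * 0 ^ p / M p) = 0 := by
  rcases Nat.eq_zero_or_pos p with rfl | hp
  · simp [(hM 0).ne']
  · simp [hp.ne']

lemma assocWeight_term (hM : ∀ p, 0 < M p) {t : ℝ} (ht : 0 < t) (p : ℕ) :
    Real.log (M 0 * t ^ p / M p) = Real.log (M 0) + p * Real.log t - Real.log (M p) := by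
  have := hM 0
  have := hM p
  rw [Real.log_div (by positivity) (by positivity), Real.log_mul (by positivity) (by positivity),
    Real.log_pow]

lemma HasAssocWeight.nonneg (hM : HasAssocWeight M) (h : ∀ p, 0 < M p) (t : ℝ) (ht : 0 ≤ t) :
    0 ≤ assocWeight M t := by
  have := hM.le ht 0
  rwa [pow_zero, mul_one, div_self (h 0).ne', Real.log_one] at this

lemma SeqDom.assocWeight_term_le (hM : ∀ p, 0 < M p) (hN : ∀ p, 0 < N p) (h : SeqDom M N) :
    ∃ a : ℝ, 0 < a ∧ ∃ c : ℝ, ∀ t, 0 ≤ t → ∀ p,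
      Real.log (N 0 * t ^ p / N p) ≤ Real.log (M 0 * (a * t) ^ p / M p) + c := by
  obtain ⟨C, a, hC, ha, h⟩ := h
  refine ⟨a, ha, Real.log C + Real.log (N 0) - Real.log (M 0), fun t ht p => ?_⟩
  have h3 : ∀ p, Real.log (M p) ≤ Real.log C + p * Real.log a + Real.log (N p) := fun p => by
    have := hN p
    have h2 := Real.log_le_log (hM p) (h p)
    rwa [Real.log_mul (by positivity) (by positivity), Real.log_mul (by positivity) (by positivity),
      Real.log_pow] at h2
  rcases ht.eq_or_lt with rfl | ht
  · rw [mul_zero, assocWeight_term_zero hM, assocWeight_term_zero hN]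
    have := h3 0
    simp only [Nat.cast_zero, zero_mul] at this
    linarith
  · rw [assocWeight_term hM (by positivity), assocWeight_term hN ht,
      Real.log_mul ha.ne' ht.ne', mul_add]
    linarith [h3 p]

lemma HasAssocWeight.of_seqDom (hM : ∀ p, 0 < M p) (hN : ∀ p, 0 < N p) (h : SeqDom M N)
    (hb : HasAssocWeight M) : HasAssocWeight N := by
  obtain ⟨a, ha, c, H⟩ := h.assocWeight_term_le hM hN
  refine fun t ht => ⟨assocWeight M (a * t) + c, ?_⟩
  rintro _ ⟨p, rfl⟩
  exact (H t ht p).trans (by gcongr; exact hb.le (by positivity) p)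

lemma HasAssocWeight.assocWeight_le (hM : ∀ p, 0 < M p) (hN : ∀ p, 0 < N p) (h : SeqDom M N)
    (hb : HasAssocWeight M) : ∃ a : ℝ, 0 < a ∧ ∃ c : ℝ, ∀ t, 0 ≤ t →
      assocWeight N t ≤ assocWeight M (a * t) + c := by
  obtain ⟨a, ha, c, H⟩ := h.assocWeight_term_le hM hN
  exact ⟨a, ha, c, fun t ht => ciSup_le fun p =>
    (H t ht p).trans (by gcongr; exact hb.le (by positivity) p)⟩

namespace IsBMTWeight

lemma youngConj_zero (hω : IsBMTWeight ω) : youngConj ω 0 = 0 := by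
  refine le_antisymm (youngConj_le fun y _ => ?_) ?_
  · linarith [hω.nonneg _ (Real.exp_pos y).le]
  · simpa [hω.map_one] using hω.hasYoungConj.le le_rfl le_rfl

lemma assocMatrix_zero (hω : IsBMTWeight ω) (ℓ : ℝ) : assocMatrix ω ℓ 0 = 1 := by
  simp [assocMatrix, hω.youngConj_zero]

lemma youngConj_nonneg (hω : IsBMTWeight ω) {x : ℝ} (hx : 0 ≤ x) : 0 ≤ youngConj ω x := by
  simpa [hω.map_one] using hω.hasYoungConj.le hx le_rfl

lemma log_assocMatrix (ω : ℝ → ℝ) (ℓ : ℝ) (p : ℕ) :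
    Real.log (assocMatrix ω ℓ p) = youngConj ω (ℓ * p) / ℓ := by
  rw [assocMatrix, Real.log_exp, one_div, inv_mul_eq_div]

lemma assocWeight_term_le (hω : IsBMTWeight ω) {ℓ : ℝ} (hℓ : 0 < ℓ) {t : ℝ} (ht : 0 ≤ t) (p : ℕ) :
    Real.log (assocMatrix ω ℓ 0 * t ^ p / assocMatrix ω ℓ p) ≤ ω t / ℓ := by
  have hn := hω.nonneg t ht
  rcases ht.eq_or_lt with rfl | ht
  · rw [assocWeight_term_zero (assocMatrix_pos ω ℓ)]
    positivity
  · rw [assocWeight_term (assocMatrix_pos ω ℓ) ht, hω.assocMatrix_zero, Real.log_one, zero_add,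
      log_assocMatrix, sub_le_iff_le_add, ← add_div, le_div_iff₀ hℓ]
    -- For `t ≥ 1` this is Young's inequality at `y = log t`. For `t ≤ 1` that point is not
    -- admissible, but `p log t ≤ 0` suffices.
    rcases le_total 1 t with h1 | h1
    · have := hω.hasYoungConj.le (x := ℓ * p) (by positivity) (Real.log_nonneg h1)
      rw [Real.exp_log ht] at this
      linarith
    · have := hω.youngConj_nonneg (x := ℓ * p) (by positivity)
      have h2 := Real.log_nonpos ht.le h1
      have : (p : ℝ) * Real.log t * ℓ ≤ 0 :=
        mul_nonpos_of_nonpos_of_nonneg (mul_nonpos_of_nonneg_of_nonpos (by positivity) h2) hℓ.le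
      linarith

lemma hasAssocWeight (hω : IsBMTWeight ω) {ℓ : ℝ} (hℓ : 0 < ℓ) :
    HasAssocWeight (assocMatrix ω ℓ) := by
  refine fun t ht => ⟨ω t / ℓ, ?_⟩
  rintro _ ⟨p, rfl⟩
  exact hω.assocWeight_term_le hℓ ht p

/-- The right derivative at `y` is the slope of a supporting line of the convex function; it is
nonnegative by monotonicity. -/
lemma exists_subgradient (hω : IsBMTWeight ω) (y : ℝ) : ∃ x : ℝ, 0 ≤ x ∧
    ∀ z, ω (Real.exp y) + x * (z - y) ≤ ω (Real.exp z) := by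
  have hc := hω.convexOn_exp
  have hy : y ∈ interior (Set.univ : Set ℝ) := by simp
  have hright : ∀ z, y < z →
      ω (Real.exp y) + derivWithin (fun t => ω (Real.exp t)) (Set.Ioi y) y * (z - y) ≤
        ω (Real.exp z) := fun z hz => by
    have h1 := hc.rightDeriv_le_slope_of_mem_interior hy (Set.mem_univ z) hz
    rw [slope_def_field, le_div_iff₀ (by linarith)] at h1
    linarith
  have hleft : ∀ z, z < y →
      ω (Real.exp y) + derivWithin (fun t => ω (Real.exp t)) (Set.Ioi y) y * (z - y) ≤
        ω (Real.exp z) := fun z hz => by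
    have h1 := (hc.slope_le_leftDeriv_of_mem_interior (Set.mem_univ z) hy hz).trans
      (hc.leftDeriv_le_rightDeriv_of_mem_interior hy)
    rw [slope_def_field, div_le_iff₀ (by linarith)] at h1
    linarith
  refine ⟨derivWithin (fun t => ω (Real.exp t)) (Set.Ioi y) y, ?_, fun z => ?_⟩
  · have h1 := hleft (y - 1) (by linarith)
    have h2 := hω.monotoneOn (Set.mem_Ici.2 (Real.exp_pos (y - 1)).le)
      (Set.mem_Ici.2 (Real.exp_pos y).le) (Real.exp_le_exp.2 (by linarith))
    linarith
  · rcases lt_trichotomy z y with h | rfl | h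
    · exact hleft z h
    · simp
    · exact hright z h

lemma le_assocWeight (hω : IsBMTWeight ω) {ℓ : ℝ} (hℓ : 0 < ℓ) {t : ℝ} (ht : 1 ≤ t) :
    ω t ≤ ℓ * assocWeight (assocMatrix ω ℓ) t + ℓ * Real.log t := by
  have ht0 : 0 < t := by linarith
  obtain ⟨x, hx, h⟩ := hω.exists_subgradient (Real.log t)
  rw [Real.exp_log ht0] at h
  have hlog := Real.log_nonneg ht
  -- The supremum recovering `ω t` is attained at the supporting slope `x`, but only multiples of
  -- `ℓ` are available. Rounding `x` down to one loses at most `ℓ log t`.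
  have hp1 : ℓ * (⌊x / ℓ⌋₊ : ℝ) ≤ x := by
    rw [mul_comm, ← le_div_iff₀ hℓ]
    exact Nat.floor_le (by positivity)
  have hp2 : x ≤ ℓ * (⌊x / ℓ⌋₊ : ℝ) + ℓ := by
    have := (Nat.lt_floor_add_one (x / ℓ)).le
    rw [div_le_iff₀ hℓ] at this
    linarith
  have h1 : youngConj ω (ℓ * (⌊x / ℓ⌋₊ : ℝ)) ≤ x * Real.log t - ω t := youngConj_le fun z hz => by
    nlinarith [h z]
  have h2 := (hω.hasAssocWeight hℓ).le ht0.le ⌊x / ℓ⌋₊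
  rw [assocWeight_term (assocMatrix_pos ω ℓ) ht0, hω.assocMatrix_zero, Real.log_one, zero_add,
    log_assocMatrix, sub_le_iff_le_add, ← sub_le_iff_le_add', le_div_iff₀ hℓ] at h2
  nlinarith

lemma assocWeight_weightLE (hω : IsBMTWeight ω) {ℓ : ℝ} (hℓ : 0 < ℓ) :
    WeightLE (assocWeight (assocMatrix ω ℓ)) ω :=
  ⟨1 / ℓ, by positivity, 0, fun t ht => by
    rw [add_zero, one_div, inv_mul_eq_div]
    exact ciSup_le fun p => hω.assocWeight_term_le hℓ ht p⟩

lemma weightLE_assocWeight (hω : IsBMTWeight ω) {ℓ : ℝ} (hℓ : 0 < ℓ) :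
    WeightLE ω (assocWeight (assocMatrix ω ℓ)) := by
  -- With this `ε` the rounding loss `ℓ log t` is at most `ω t / 2 + ℓ B`, which is absorbed on the
  -- left at the price of a factor `2`.
  obtain ⟨B, hB, h⟩ := hω.log_le (ε := 1 / (2 * ℓ)) (by positivity)
  refine ⟨2 * ℓ, by positivity, 2 * ℓ * B, fun t ht => ?_⟩
  rcases le_total 1 t with h1 | h1
  · have h2 := hω.le_assocWeight hℓ h1
    have h3 := h t h1
    rw [one_div, inv_mul_eq_div, ← sub_le_iff_le_add, le_div_iff₀ (by positivity)] at h3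
    linarith
  · rw [hω.eq_zero t ⟨ht, h1⟩]
    have := (hω.hasAssocWeight hℓ).nonneg (assocMatrix_pos ω ℓ) t ht
    positivity

end IsBMTWeight

/-! ### The associated weight function of the conjugate sequence -/

/-- The series of `exp (x / 2)` has terms `2 ^ (-p) x ^ p / p!`, and the weights `2 ^ (-p)` sum to
`2`. If every `x ^ p / p!` were below a third of the sum, the sum would be at most two thirds of
itself. -/
lemma exp_half_le (x : ℝ) :
    ∃ p : ℕ, Real.exp (x / 2) ≤ 3 * (x ^ p / (p.factorial : ℝ)) := by
  by_contra! hcon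
  have h1 : HasSum (fun p : ℕ => (x / 2) ^ p / (p.factorial : ℝ)) (Real.exp (x / 2)) := by
    rw [Real.exp_eq_exp_ℝ]
    exact NormedSpace.expSeries_div_hasSum_exp (x / 2)
  have h2 := hasSum_geometric_two.mul_left (Real.exp (x / 2) / 3)
  have h3 := hasSum_le (fun p => ?_) h1 h2
  · linarith [Real.exp_pos (x / 2)]
  · have h4 := mul_le_mul_of_nonneg_right (hcon p).le (show (0 : ℝ) ≤ (1 / 2) ^ p / 3 by positivity)
    calc (x / 2) ^ p / (p.factorial : ℝ) =
          3 * (x ^ p / (p.factorial : ℝ)) * ((1 / 2) ^ p / 3) := by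
          rw [div_eq_mul_one_div x 2, mul_pow]; ring
      _ ≤ _ := h4.trans (by rw [mul_div_assoc', div_mul_eq_mul_div])

namespace IsBMTWeight

lemma log_conjSeq (ω : ℝ → ℝ) (ℓ : ℝ) (p : ℕ) : Real.log (conjSeq (assocMatrix ω ℓ) p) =
    Real.log (p.factorial) - youngConj ω (ℓ * p) / ℓ := by
  rw [conjSeq, Real.log_div (by positivity) (assocMatrix_pos ω ℓ p).ne', log_assocMatrix]

lemma conjSeq_zero (hω : IsBMTWeight ω) (ℓ : ℝ) : conjSeq (assocMatrix ω ℓ) 0 = 1 := by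
  simp [conjSeq, hω.assocMatrix_zero]

lemma assocWeight_conjSeq_term_le (hω : IsBMTWeight ω) (hC : (fun t : ℝ => t) =o[atTop] ω) {ℓ : ℝ}
    (hℓ : 0 < ℓ) {t : ℝ} (ht : 0 ≤ t) (p : ℕ) :
    Real.log (conjSeq (assocMatrix ω ℓ) 0 * t ^ p / conjSeq (assocMatrix ω ℓ) p) ≤
      conjWeight ω (ℓ * t) / ℓ := by
  have hpos := conjSeq_pos (assocMatrix_pos ω ℓ)
  have hn := hω.conjWeight_nonneg hC (ℓ * t) (by positivity)
  rcases ht.eq_or_lt with rfl | ht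
  · rw [assocWeight_term_zero hpos]
    positivity
  · rw [assocWeight_term hpos ht, hω.conjSeq_zero, Real.log_one, zero_add, log_conjSeq]
    -- The inequality `(t e^y) ^ p / p! ≤ exp (t e^y)` bounds the linear term in the Young supremum,
    -- and the definition of `ω*` at `ℓ t` bounds the rest.
    have h1 : youngConj ω (ℓ * p) ≤
        conjWeight ω (ℓ * t) - ℓ * (p * Real.log t - Real.log p.factorial) :=
      youngConj_le fun y hy => by
        have h2 := (hω.hasConj hC).le (s := ℓ * t) (by positivity) (Real.exp_pos y).le
        have h3 := Real.pow_div_factorial_le_exp (t * Real.exp y) (by positivity) p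
        have h4 := Real.log_le_log (by positivity) h3
        rw [Real.log_exp, Real.log_div (by positivity) (by positivity), Real.log_pow,
          Real.log_mul ht.ne' (Real.exp_pos y).ne', Real.log_exp] at h4
        nlinarith
    rw [le_div_iff₀ hℓ, sub_mul, sub_mul, div_mul_cancel₀ _ hℓ.ne']
    linarith

lemma hasAssocWeight_conjSeq (hω : IsBMTWeight ω) (hC : (fun t : ℝ => t) =o[atTop] ω) {ℓ : ℝ}
    (hℓ : 0 < ℓ) : HasAssocWeight (conjSeq (assocMatrix ω ℓ)) := by
  refine fun t ht => ⟨conjWeight ω (ℓ * t) / ℓ, ?_⟩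
  rintro _ ⟨p, rfl⟩
  exact hω.assocWeight_conjSeq_term_le hC hℓ ht p

lemma conjWeight_le_assocWeight_conjSeq (hω : IsBMTWeight ω) (hC : (fun t : ℝ => t) =o[atTop] ω)
    {ℓ : ℝ} (hℓ : 0 < ℓ) {t : ℝ} (ht : 0 ≤ t) :
    conjWeight ω (ℓ / 2 * t) ≤
      ℓ * assocWeight (conjSeq (assocMatrix ω ℓ)) t + ℓ * Real.log 3 := by
  have hpos := conjSeq_pos (assocMatrix_pos ω ℓ)
  have hb := hω.hasAssocWeight_conjSeq hC hℓ
  have hlog3 : 0 ≤ Real.log 3 := Real.log_nonneg (by norm_num)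
  rcases ht.eq_or_lt with rfl | ht
  · have h0 := hb.nonneg hpos 0 le_rfl
    have : conjWeight ω (ℓ / 2 * 0) ≤ 0 := conjWeight_le fun t ht => by
      linarith [hω.nonneg t ht]
    linarith [mul_nonneg hℓ.le h0, mul_nonneg hℓ.le hlog3]
  -- The exponential lower bound at `t u` selects an index `p` for which `t u / 2` is almost `log
  -- ((t u) ^ p / p!)`. Young's inequality at `log u` then separates `t` from `u`, which is why `u ≥
  -- 1` is treated first.
  have key : ∀ u, 1 ≤ u → ℓ / 2 * t * u - ω u ≤
      ℓ * assocWeight (conjSeq (assocMatrix ω ℓ)) t + ℓ * Real.log 3 := by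
    intro u hu
    have hu0 : 0 < u := by linarith
    obtain ⟨p, hp⟩ := exp_half_le (t * u)
    have h1 := Real.log_le_log (Real.exp_pos _) hp
    rw [Real.log_exp, Real.log_mul (by positivity) (by positivity),
      Real.log_div (by positivity) (by positivity), Real.log_pow,
      Real.log_mul ht.ne' hu0.ne'] at h1
    have h2 := hb.le ht.le p
    rw [assocWeight_term hpos ht, hω.conjSeq_zero, Real.log_one, zero_add, log_conjSeq] at h2
    have h3 := hω.hasYoungConj.le (x := ℓ * p) (by positivity) (Real.log_nonneg hu)
    rw [Real.exp_log hu0] at h3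
    have h4 := mul_le_mul_of_nonneg_left h2 hℓ.le
    rw [mul_sub, mul_sub, mul_div_cancel₀ _ hℓ.ne'] at h4
    nlinarith
  refine conjWeight_le fun u hu => ?_
  rcases le_total 1 u with h | h
  · exact key u h
  · have h1 := key 1 le_rfl
    rw [hω.map_one] at h1
    have h2 := hω.nonneg u hu
    have h3 : ℓ / 2 * t * u ≤ ℓ / 2 * t * 1 := by gcongr
    linarith

/-- All sequences equivalent to the conjugate of a sequence of the associated weight matrix have
an associated weight function equivalent to the conjugate weight function. -/
lemma assocWeight_equiv_conjWeight (hω : IsBMTWeight ω) (hC : (fun t : ℝ => t) =o[atTop] ω)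
    (hγ : upperIndex ω < 1) {ℓ : ℝ} (hℓ : 0 < ℓ) (hN : ∀ p, 0 < N p)
    (h : SeqDom N (conjSeq (assocMatrix ω ℓ))) (h' : SeqDom (conjSeq (assocMatrix ω ℓ)) N) :
    HasAssocWeight N ∧ WeightLE (assocWeight N) (conjWeight ω) ∧
      WeightLE (conjWeight ω) (assocWeight N) := by
  have hpos := conjSeq_pos (assocMatrix_pos ω ℓ)
  have hb := hω.hasAssocWeight_conjSeq hC hℓ
  have hbN := hb.of_seqDom hpos hN h'
  refine ⟨hbN, ?_, ?_⟩
  · obtain ⟨a, ha, c, H⟩ := hb.assocWeight_le hpos hN h'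
    obtain ⟨B, hB, B', H'⟩ := hω.conjWeight_moderate hC hγ (R := ℓ * a) (by positivity)
    refine ⟨B / ℓ, by positivity, B' / ℓ + c, fun t ht => ?_⟩
    have h1 : assocWeight (conjSeq (assocMatrix ω ℓ)) (a * t) ≤ conjWeight ω (ℓ * (a * t)) / ℓ :=
      ciSup_le fun p => hω.assocWeight_conjSeq_term_le hC hℓ (by positivity) p
    have h2 := H' t ht
    rw [mul_assoc] at h2
    have h3 : conjWeight ω (ℓ * (a * t)) / ℓ ≤ (B * conjWeight ω t + B') / ℓ := by gcongr
    calc assocWeight N t ≤ (B * conjWeight ω t + B') / ℓ + c :=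
          (H t ht).trans (by linarith)
      _ = _ := by ring
  · obtain ⟨a, ha, c, H⟩ := hbN.assocWeight_le hN hpos h
    -- This `R` undoes both the factor `ℓ / 2` from the exponential estimate and the dilation by `a`
    -- from passing between equivalent sequences.
    obtain ⟨B, hB, B', H'⟩ := hω.conjWeight_moderate hC hγ (R := 2 * a / ℓ) (by positivity)
    refine ⟨B * ℓ, by positivity, B * ℓ * (c + Real.log 3) + B', fun t ht => ?_⟩
    have h1 := H (t / a) (by positivity)
    rw [mul_div_cancel₀ _ ha.ne'] at h1
    have h2 := hω.conjWeight_le_assocWeight_conjSeq hC hℓ (t := t / a) (by positivity)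
    have h3 := H' (ℓ / 2 * (t / a)) (by positivity)
    have h4 : 2 * a / ℓ * (ℓ / 2 * (t / a)) = t := by field_simp
    rw [h4] at h3
    have h5 : B * conjWeight ω (ℓ / 2 * (t / a)) ≤
        B * (ℓ * (assocWeight N t + c) + ℓ * Real.log 3) := by
      gcongr
      exact h2.trans (by gcongr)
    linarith

end IsBMTWeight

end AssociatedWeights

/-! ### Log-convex sequences -/

section LogConvexSequences

variable {M N : ℕ → ℝ}

lemma IsLogConvex.monotone_quotient (hN : ∀ p, 0 < N p) (h : IsLogConvex N) :
    Monotone fun p => N (p + 1) / N p :=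
  monotone_nat_of_le_succ fun p => by
    rw [div_le_div_iff₀ (hN _) (hN _)]
    nlinarith [h p]

/-- With `r = N (p + 1) / N p`, the sequence `r ^ q / N q` is maximal at `q = p`: consecutive
quotients of `N` are at most `r` before `p` and at least `r` from `p` on. -/
lemma IsLogConvex.quotient_pow_mul_le (hN : ∀ p, 0 < N p) (h : IsLogConvex N) (p q : ℕ) :
    (N (p + 1) / N p) ^ q * N p ≤ (N (p + 1) / N p) ^ p * N q := by
  have hmono := h.monotone_quotient hN
  set r := N (p + 1) / N p with hr
  have hr0 : 0 < r := div_pos (hN _) (hN _)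
  rcases le_total p q with hpq | hpq
  · obtain ⟨k, rfl⟩ := Nat.exists_eq_add_of_le hpq
    rw [pow_add, mul_assoc]
    refine mul_le_mul_of_nonneg_left ?_ (by positivity)
    clear hpq
    induction k with
    | zero => simp
    | succ k ih =>
      have h1 : r ≤ N (p + k + 1) / N (p + k) := hmono (Nat.le_add_right p k)
      rw [le_div_iff₀ (hN _)] at h1
      calc r ^ (k + 1) * N p = r * (r ^ k * N p) := by ring
        _ ≤ r * N (p + k) := mul_le_mul_of_nonneg_left ih hr0.le
        _ ≤ _ := h1
  · obtain ⟨k, hk⟩ := Nat.exists_eq_add_of_le hpq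
    have key : ∀ j, q + j ≤ p → N (q + j) ≤ r ^ j * N q := by
      intro j
      induction j with
      | zero => simp
      | succ j ih =>
        intro hj
        have h1 : N (q + j + 1) / N (q + j) ≤ r := hmono (by omega)
        rw [div_le_iff₀ (hN _)] at h1
        calc N (q + j + 1) ≤ r * N (q + j) := h1
          _ ≤ r * (r ^ j * N q) := mul_le_mul_of_nonneg_left (ih (by omega)) hr0.le
          _ = _ := by ring
    have h2 := key k hk.ge
    rw [← hk] at h2
    calc r ^ q * N p ≤ r ^ q * (r ^ k * N q) := mul_le_mul_of_nonneg_left h2 (by positivity)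
      _ = r ^ p * N q := by rw [← mul_assoc, ← pow_add, ← hk]

/-- A normalized log-convex sequence is recovered from its associated weight function. -/
lemma assocMatrix_assocWeight (hN : ∀ p, 0 < N p) (h0 : N 0 = 1) (h1 : 1 ≤ N 1)
    (hc : IsLogConvex N) (hb : HasAssocWeight N) (hy : HasYoungConj (assocWeight N)) (p : ℕ) :
    assocMatrix (assocWeight N) 1 p = N p := by
  suffices h : youngConj (assocWeight N) p = Real.log (N p) by
    rw [assocMatrix, one_mul, div_one, one_mul, h, Real.exp_log (hN p)]
  refine le_antisymm (youngConj_le fun y _ => ?_) ?_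
  · have := hb.le (Real.exp_pos y).le p
    rw [assocWeight_term hN (Real.exp_pos y), h0, Real.log_one, Real.log_exp] at this
    linarith
  · have hr : 1 ≤ N (p + 1) / N p := by
      have := hc.monotone_quotient hN (Nat.zero_le p)
      simp only [zero_add, h0, div_one] at this
      linarith
    set r := N (p + 1) / N p with hrdef
    have hr0 : 0 < r := by linarith
    have h2 := hy.le (x := p) (by positivity) (Real.log_nonneg hr)
    rw [Real.exp_log hr0] at h2
    have h3 : assocWeight N r ≤ p * Real.log r - Real.log (N p) := ciSup_le fun q => by
      rw [assocWeight_term hN hr0, h0, Real.log_one, zero_add]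
      have hNp := hN p
      have hNq := hN q
      have := Real.log_le_log (by positivity) (hc.quotient_pow_mul_le hN p q)
      rw [← hrdef, Real.log_mul (by positivity) (by positivity),
        Real.log_mul (by positivity) (by positivity), Real.log_pow, Real.log_pow] at this
      linarith
    linarith

/-! ### Regularization -/

/-- If `w` is increasing and `w_p / p` is almost decreasing, then `w` is equivalent to an increasing
sequence `m` such that `m_p / p` is decreasing (with indices shifted by one). -/
lemma exists_regular_quotients {w : ℕ → ℝ} {D : ℝ} (hw : ∀ p, 0 < w p)
    (hmono : ∀ p, 1 ≤ p → w p ≤ w (p + 1))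
    (hD : ∀ p q : ℕ, 1 ≤ p → p ≤ q → w q / q ≤ D * (w p / p)) :
    ∃ m : ℕ → ℝ, (∀ k, w (k + 1) ≤ m k) ∧ (∀ k, m k ≤ D * w (k + 1)) ∧ Monotone m ∧
      ∀ k : ℕ, m (k + 1) / (k + 2) ≤ m k / (k + 1) := by
  -- The least decreasing majorant of `w_p / p`; the hypothesis `hD` bounds it by `D` times `w_p /
  -- p`. The sequence sought is `(k + 1) ν k`.
  set ν : ℕ → ℝ := fun k => ⨆ q : ℕ, w (k + q + 1) / (k + q + 1 : ℕ) with hν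
  have hb : ∀ k, BddAbove (Set.range fun q : ℕ => w (k + q + 1) / ((k + q + 1 : ℕ) : ℝ)) := by
    refine fun k => ⟨D * (w (k + 1) / (k + 1 : ℕ)), ?_⟩
    rintro _ ⟨q, rfl⟩
    exact hD _ _ (by omega) (by omega)
  have hle : ∀ k q : ℕ, w (k + q + 1) / ((k + q + 1 : ℕ) : ℝ) ≤ ν k := fun k q => le_ciSup (hb k) q
  have hge : ∀ k, ν k ≤ D * (w (k + 1) / (k + 1 : ℕ)) := fun k =>
    ciSup_le fun q => hD _ _ (by omega) (by omega)
  have hν0 : ∀ k, 0 ≤ ν k := fun k => le_trans (by have := hw (k + 0 + 1); positivity) (hle k 0)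
  have hlow : ∀ k, w (k + 1) ≤ (k + 1) * ν k := fun k => by
    have := hle k 0
    rw [add_zero, div_le_iff₀ (by positivity)] at this
    push_cast at this
    linarith
  refine ⟨fun k => (k + 1) * ν k, hlow, fun k => ?_, monotone_nat_of_le_succ fun k => ?_,
    fun k => ?_⟩
  · have := mul_le_mul_of_nonneg_left (hge k) (show (0 : ℝ) ≤ k + 1 by positivity)
    refine this.trans_eq ?_
    push_cast
    field_simp
  · rw [← le_div_iff₀' (by positivity)]
    refine ciSup_le fun q => ?_
    rw [le_div_iff₀' (by positivity)]
    -- Only the leading term `q = 0` is absent from the supremum defining `ν (k + 1)`; monotonicity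
    -- of `w` handles it.
    rcases q with _ | q
    · have h1 := (hmono (k + 1) (by omega)).trans (hlow (k + 1))
      push_cast at h1 ⊢
      simp only [add_zero]
      rwa [mul_div_cancel₀ _ (by positivity)]
    · have h1 := hle (k + 1) q
      have e : k + 1 + q + 1 = k + (q + 1) + 1 := by ring
      rw [e] at h1
      refine mul_le_mul (by push_cast; linarith) h1 ?_ (by positivity)
      have := hw (k + (q + 1) + 1)
      positivity
  · have h1 : ν (k + 1) ≤ ν k := ciSup_le fun q => by
      have e : k + 1 + q + 1 = k + (q + 1) + 1 := by ring
      rw [e]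
      exact hle k (q + 1)
    simp only [Nat.cast_add, Nat.cast_one]
    rwa [mul_div_cancel_left₀ _ (by positivity), add_assoc, one_add_one_eq_two,
      mul_div_cancel_left₀ _ (by positivity)]

/-- Since `m k / (k + 1)` decreases, each factor is at least `(k + 1) m p / (p + 1)`. The resulting
factorial is estimated by `n! ≥ (n / e) ^ n`. -/
lemma pow_mul_exp_le_prod {m : ℕ → ℝ} (hm : ∀ k, 0 < m k)
    (hanti : ∀ k : ℕ, m (k + 1) / (k + 2) ≤ m k / (k + 1)) (p : ℕ) :
    (m p / Real.exp 1) ^ (p + 1) ≤ ∏ k ∈ Finset.range (p + 1), m k := by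
  have hA : Antitone fun k : ℕ => m k / (k + 1) := antitone_nat_of_succ_le fun k => by
    have := hanti k
    push_cast
    rw [add_assoc, one_add_one_eq_two]
    exact this
  have h1 : ∏ k ∈ Finset.range (p + 1), (m p / (p + 1) * ((k + 1 : ℕ) : ℝ)) ≤
      ∏ k ∈ Finset.range (p + 1), m k := by
    have := hm p
    refine Finset.prod_le_prod (fun k _ => by positivity) fun k hk => ?_
    have h2 : m p / (p + 1) ≤ m k / (k + 1) := hA (by simpa [Nat.lt_succ_iff] using hk)
    rw [le_div_iff₀ (by positivity)] at h2
    exact_mod_cast h2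
  rw [Finset.prod_mul_distrib, Finset.prod_const, Finset.card_range, ← Nat.cast_prod,
    Finset.prod_range_add_one_eq_factorial] at h1
  refine le_trans ?_ h1
  have h3 := Real.pow_div_factorial_le_exp ((p + 1 : ℕ) : ℝ) (by positivity) (p + 1)
  rw [div_le_iff₀ (by positivity), ← mul_one ((p + 1 : ℕ) : ℝ), Real.exp_nat_mul, mul_one] at h3
  push_cast at h3
  have := hm p
  rw [div_pow, div_pow, div_mul_eq_mul_div, div_le_div_iff₀ (by positivity) (by positivity),
    mul_assoc]
  refine mul_le_mul_of_nonneg_left ?_ (by positivity)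
  rw [mul_comm]
  linarith

/-- Existence of a regularization of a sequence whose roots are increasing and almost concave. -/
lemma exists_regularization {w W : ℕ → ℝ} {D : ℝ} (hw : ∀ p, 0 < w p) (hW0 : W 0 = 1)
    (hW : ∀ p, 1 ≤ p → W p = w p ^ p) (hmono : ∀ p, 1 ≤ p → w p ≤ w (p + 1))
    (hD : ∀ p q : ℕ, 1 ≤ p → p ≤ q → w q / q ≤ D * (w p / p))
    (hlim : Tendsto w atTop atTop) (hlim' : Tendsto (fun p : ℕ => p / w p) atTop atTop) :
    ∃ V : ℕ → ℝ, IsRegularization W V ∧ IsLC V ∧ IsLC (conjSeq V) := by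
  obtain ⟨m', hm1', hm2', hm3', hm4'⟩ := exists_regular_quotients hw hmono hD
  have hm0' : ∀ k, 0 < m' k := fun k => (hw _).trans_le (hm1' k)
  have hD0 : 0 < D := by
    have h1 := (hm0' 0).trans_le (hm2' 0)
    exact pos_of_mul_pos_left h1 (hw _).le
  -- Dividing by `b` makes the first quotient `1`, so that `V 1 = 1` and both `V` and its conjugate
  -- are normalized; the equivalence with `W` is unaffected.
  set b := m' 0 with hbdef
  have hb : 0 < b := hm0' 0
  set m : ℕ → ℝ := fun k => m' k / b with hm
  have hm0 : ∀ k, 0 < m k := fun k => div_pos (hm0' k) hb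
  have hm_zero : m 0 = 1 := div_self hb.ne'
  have hm_mono : Monotone m := fun i j hij => div_le_div_of_nonneg_right (hm3' hij) hb.le
  have hm_anti : ∀ k : ℕ, m (k + 1) / (k + 2) ≤ m k / (k + 1) := fun k => by
    have := div_le_div_of_nonneg_right (hm4' k) hb.le
    rwa [div_right_comm, div_right_comm (m' k)] at this
  set V : ℕ → ℝ := fun p => ∏ k ∈ Finset.range p, m k with hV
  have hVs : ∀ p, V (p + 1) = V p * m p := fun p => Finset.prod_range_succ m p
  have hV0 : V 0 = 1 := Finset.prod_range_zero m
  have hV1 : V 1 = 1 := by rw [hVs, hV0, hm_zero, one_mul]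
  have hVpos : ∀ p, 0 < V p := fun p => Finset.prod_pos fun k _ => hm0 k
  have hWpos : ∀ p, 0 < W p := fun p => by
    rcases Nat.eq_zero_or_pos p with rfl | hp
    · rw [hW0]; exact one_pos
    · rw [hW p hp]; exact pow_pos (hw p) p
  have hup : ∀ p, 1 ≤ p → V p ≤ (D * w p / b) ^ p := by
    intro p hp
    obtain ⟨p, rfl⟩ := Nat.exists_eq_add_of_le' hp
    calc V (p + 1) ≤ ∏ k ∈ Finset.range (p + 1), m p :=
          Finset.prod_le_prod (fun k _ => (hm0 k).le) fun k hk =>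
            hm_mono (by simpa [Nat.lt_succ_iff] using hk)
      _ = m p ^ (p + 1) := by rw [Finset.prod_const, Finset.card_range]
      _ ≤ _ := by
        refine pow_le_pow_left₀ (hm0 p).le ?_ _
        exact div_le_div_of_nonneg_right (hm2' p) hb.le
  have hdown : ∀ p, 1 ≤ p → (w p / (b * Real.exp 1)) ^ p ≤ V p := by
    intro p hp
    obtain ⟨p, rfl⟩ := Nat.exists_eq_add_of_le' hp
    refine le_trans (pow_le_pow_left₀ ?_ ?_ _) (pow_mul_exp_le_prod hm0 hm_anti p)
    · have := hw (p + 1)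
      positivity
    · rw [← div_div]
      exact div_le_div_of_nonneg_right (div_le_div_of_nonneg_right (hm1' p) hb.le)
        (Real.exp_pos 1).le
  have hroot : ∀ {x y : ℝ} {p : ℕ}, 1 ≤ p → 0 ≤ x → x ^ p ≤ y → x ≤ y ^ (1 / (p : ℝ)) := by
    intro x y p hp hx hxy
    have := Real.rpow_le_rpow (by positivity) hxy (show 0 ≤ 1 / (p : ℝ) by positivity)
    rwa [one_div, Real.pow_rpow_inv_natCast hx (by omega), ← one_div] at this
  refine ⟨V, ⟨hVpos, ⟨?_, ?_⟩, ?_, ?_⟩, ⟨hVpos, hV0, hV1.ge, ?_, ?_⟩,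
    ⟨conjSeq_pos hVpos, by simp [conjSeq, hV0], by simp [conjSeq, hV1], ?_, ?_⟩⟩
  · refine SeqLE.of_le hVpos hWpos (h := D / b) (by positivity) fun p hp => ?_
    rw [hW p hp, ← mul_pow, div_mul_eq_mul_div]
    exact hup p hp
  · refine SeqLE.of_le hWpos hVpos (h := b * Real.exp 1) (by positivity) fun p hp => ?_
    rw [hW p hp]
    have := hdown p hp
    rwa [div_pow, div_le_iff₀' (by positivity)] at this
  · intro p
    rw [hVs (p + 1), hVs p]
    have h1 := hm_mono (Nat.le_succ p)
    have h2 := mul_le_mul_of_nonneg_left h1 (mul_nonneg (sq_nonneg (V p)) (hm0 p).le)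
    calc _ = V p ^ 2 * m p * m p := by ring
      _ ≤ _ := h2
      _ = _ := by ring
  · intro p
    simp only [Nat.factorial_succ, hVs]
    push_cast
    have h1 := hm_anti p
    have h2 := mul_le_mul_of_nonneg_left h1
      (show 0 ≤ (V p / p.factorial) ^ 2 * (m p / (p + 1)) by
        have := hVpos p
        have := hm0 p
        positivity)
    calc _ = (V p / p.factorial) ^ 2 * (m p / (p + 1)) * (m (p + 1) / (p + 2)) := by
          field_simp
          ring
      _ ≤ _ := h2
      _ = _ := by field_simp
  · intro p
    rw [hVs (p + 1), hVs p]
    have h1 := hm_mono (Nat.le_succ p)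
    have h2 := mul_le_mul_of_nonneg_left h1 (mul_nonneg (sq_nonneg (V p)) (hm0 p).le)
    calc _ = V p ^ 2 * m p * m p := by ring
      _ ≤ _ := h2
      _ = _ := by ring
  · refine tendsto_atTop_mono' atTop ?_
      (hlim.atTop_div_const (show 0 < b * Real.exp 1 by positivity))
    filter_upwards [eventually_ge_atTop 1] with p hp
    exact hroot hp (by have := hw p; positivity) (hdown p hp)
  · intro p
    simp only [conjSeq, Nat.factorial_succ, hVs]
    push_cast
    have h1 := hm_anti p
    have h3 := hm0 p
    have h4 := hm0 (p + 1)
    have h5 := hVpos p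
    have h6 : ((p : ℝ) + 1) / m p ≤ (p + 2) / m (p + 1) := by
      rw [div_le_div_iff₀ (by positivity) (by positivity)] at h1 ⊢
      linarith
    have h2 := mul_le_mul_of_nonneg_left h6
      (show 0 ≤ (p.factorial / V p) ^ 2 * ((p + 1) / m p) by positivity)
    calc _ = (p.factorial / V p) ^ 2 * ((p + 1) / m p) * ((p + 1) / m p) := by field_simp
      _ ≤ _ := h2
      _ = _ := by
        field_simp
        ring
  · refine tendsto_atTop_mono' atTop ?_
      (hlim'.atTop_mul_const (show 0 < b / (D * Real.exp 1) by positivity))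
    filter_upwards [eventually_ge_atTop 1] with p hp
    have h1 := hw p
    refine hroot hp (by positivity) ?_
    rw [conjSeq, le_div_iff₀ (hVpos p)]
    have h3 := Real.pow_div_factorial_le_exp (p : ℝ) (by positivity) p
    rw [div_le_iff₀ (by positivity), ← mul_one (p : ℝ), Real.exp_nat_mul, mul_one] at h3
    calc ((p : ℝ) / w p * (b / (D * Real.exp 1))) ^ p * V p
        ≤ ((p : ℝ) / w p * (b / (D * Real.exp 1))) ^ p * (D * w p / b) ^ p :=
          mul_le_mul_of_nonneg_left (hup p hp) (by positivity)
      _ = (p : ℝ) ^ p / Real.exp 1 ^ p := by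
        rw [← mul_pow, ← div_pow]
        congr 1
        field_simp
      _ ≤ _ := by
        rw [div_le_iff₀ (by positivity), mul_comm]
        exact h3

end LogConvexSequences

namespace IsBMTWeight

variable {ω : ℝ → ℝ}

/-! ### The weight matrix of a weight function with upper index less than one -/

lemma assocMatrix_seqDom (hω : IsBMTWeight ω) (hγ : upperIndex ω < 1) {ℓ ℓ' : ℝ} (hℓ : 0 < ℓ)
    (hℓ' : 0 < ℓ') : SeqDom (assocMatrix ω ℓ) (assocMatrix ω ℓ') := by
  -- With this `R`, `θ ℓ ≤ θ D ℓ ≤ ℓ'`: the dilation lowers the parameter below `ℓ'` at the price of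
  -- the factor `D ^ p`.
  obtain ⟨θ, D, B, hθ, hD, hθD, h⟩ := hω.exists_dilation hγ (R := ℓ / ℓ') (by positivity)
  have hD0 : 0 < D := by linarith
  obtain ⟨c, hc, h1⟩ := hω.hasYoungConj.assocMatrix_dilation (τ := ω) hθ (inv_pos.2 hD0)
    (C' := B) (fun t ht => by
      have := h (D⁻¹ * t) (by positivity)
      rwa [mul_inv_cancel_left₀ hD0.ne'] at this) hℓ
  have hle : θ * ℓ ≤ ℓ' := by
    have h2 : θ * (ℓ / ℓ') ≤ θ * D * (ℓ / ℓ') := by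
      gcongr
      exact le_mul_of_one_le_right hθ.le hD
    have h3 := h2.trans hθD
    rwa [mul_div_assoc', div_le_one hℓ'] at h3
  obtain ⟨c', hc', h2⟩ := hω.hasYoungConj.assocMatrix_mono (mul_pos hθ hℓ) hle
  refine ⟨c * c', D, by positivity, hD0, fun p => ?_⟩
  have h3 := h1 p
  rw [inv_pow, inv_mul_eq_div, div_le_iff₀' (by positivity)] at h3
  calc _ ≤ D ^ p * (c * assocMatrix ω (θ * ℓ) p) := h3
    _ ≤ D ^ p * (c * (c' * assocMatrix ω ℓ' p)) := by gcongr; exact h2 p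
    _ = _ := by ring

/-- The quotient is the supremum over `y` of `y - ω (exp y) / x`, and `ω` is nonnegative. -/
lemma youngConj_div_mono (hω : IsBMTWeight ω) {x x' : ℝ} (hx : 0 < x) (h : x ≤ x') :
    youngConj ω x / x ≤ youngConj ω x' / x' := by
  have hx' : 0 < x' := hx.trans_le h
  rw [div_le_iff₀ hx]
  refine youngConj_le fun y hy => ?_
  have h1 := hω.hasYoungConj.le hx'.le hy
  have h2 := hω.nonneg _ (Real.exp_pos y).le
  rw [div_mul_eq_mul_div, le_div_iff₀ hx']
  nlinarith

/-- `exp (φ* (x) / x) / x` is almost decreasing. -/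
lemma exists_youngConj_div_le (hω : IsBMTWeight ω) (hγ : upperIndex ω < 1) {ℓ : ℝ} (hℓ : 0 < ℓ) :
    ∃ B : ℝ, ∀ x y, ℓ ≤ x → x ≤ y →
      youngConj ω y / y - Real.log y ≤ youngConj ω x / x - Real.log x + B := by
  obtain ⟨K, A, C, hK, hKA, hC, h⟩ := hω.exists_growth hγ
  have hA : 1 < A := by linarith
  have hA0 : 0 < A := by linarith
  have hK0 : 0 < K := by linarith
  -- The fixed point of `c ↦ (C + c) / A`: adding it to the Young conjugate absorbs the additive
  -- error, so the step below iterates without accumulating constants.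
  set c := C / (A - 1) with hc
  have hc0 : 0 ≤ c := div_nonneg hC (by linarith)
  have hcA : C + c = A * c := by
    have : A - 1 ≠ 0 := by linarith
    rw [hc]
    field_simp
    ring
  have hstep : ∀ x, 0 < x → (youngConj ω (A * x) + c) / (A * x) ≤
      (youngConj ω x + c) / x + Real.log A := by
    intro x hx
    have h1 := hω.hasYoungConj.youngConj_dilation (τ := ω) (inv_pos.2 hA0) (inv_pos.2 hK0)
      (C' := C / A) (fun t ht => by
        have := h (K⁻¹ * t) (by positivity)
        rw [mul_inv_cancel_left₀ hK0.ne'] at this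
        rwa [inv_mul_eq_div A, ← add_div, le_div_iff₀' hA0]) (x := A * x) (by positivity)
    rw [inv_mul_cancel_left₀ hA0.ne', hω.map_one, Real.log_inv] at h1
    have h2 : (youngConj ω x + C / A + 0) / A⁻¹ = A * youngConj ω x + C := by
      field_simp
      ring
    have h3 : Real.log K ≤ Real.log A := Real.log_le_log hK0 hKA.le
    have h4 : A * x * Real.log K ≤ A * x * Real.log A := by gcongr
    rw [div_add' _ _ _ hx.ne', div_le_div_iff₀ (by positivity) hx]
    have h5 : youngConj ω (A * x) + c ≤ A * (youngConj ω x + c + Real.log A * x) := by linarith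
    nlinarith
  have hiter : ∀ (n : ℕ) (x : ℝ), 0 < x → (youngConj ω (A ^ n * x) + c) / (A ^ n * x) ≤
      (youngConj ω x + c) / x + n * Real.log A := by
    intro n x hx
    induction n with
    | zero => simp
    | succ n ih =>
      have h1 := hstep (A ^ n * x) (by positivity)
      rw [← mul_assoc, ← pow_succ'] at h1
      push_cast
      linarith
  refine ⟨c / ℓ + Real.log A, fun x y hx hxy => ?_⟩
  have hx0 : 0 < x := hℓ.trans_le hx
  have hy0 : 0 < y := hx0.trans_le hxy
  -- Here `A ^ n ≤ y / x < A ^ (n + 1)`. The `n` steps cost `n log A ≤ log y - log x`, and rounding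
  -- up costs one further `log A`.
  obtain ⟨n, hn1, hn2⟩ := exists_nat_pow_near ((one_le_div hx0).2 hxy) hA
  rw [le_div_iff₀ hx0] at hn1
  rw [div_lt_iff₀ hx0] at hn2
  have h1 := hω.youngConj_div_mono hy0 hn2.le
  have h2 := hiter (n + 1) x hx0
  have h3 := Real.log_le_log (by positivity) hn1
  rw [Real.log_mul (by positivity) hx0.ne', Real.log_pow] at h3
  have h4 : 0 ≤ c / (A ^ (n + 1) * x) := by positivity
  have h5 : c / x ≤ c / ℓ := by gcongr
  rw [add_div, add_div] at h2
  push_cast at h2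
  linarith

lemma exists_isRegularization (hω : IsBMTWeight ω) (hC : (fun t : ℝ => t) =o[atTop] ω)
    (hγ : upperIndex ω < 1) {ℓ : ℝ} (hℓ : 0 < ℓ) : ∃ V : ℕ → ℝ,
      IsRegularization (assocMatrix ω ℓ) V ∧ IsLC V ∧ IsLC (conjSeq V) := by
  obtain ⟨B, hB⟩ := hω.exists_youngConj_div_le hγ hℓ
  have hlarge : ∀ b : ℝ, ∀ᶠ p : ℕ in atTop, b ≤ ℓ * p := fun b =>
    (tendsto_natCast_atTop_atTop.const_mul_atTop hℓ).eventually_ge_atTop b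
  refine exists_regularization (w := fun p => Real.exp (youngConj ω (ℓ * p) / (ℓ * p)))
    (D := Real.exp B) (fun p => Real.exp_pos _) (hω.assocMatrix_zero ℓ) (fun p hp => ?_)
    (fun p hp => ?_) (fun p q hp hpq => ?_) ?_ ?_
  · have hp' : (0 : ℝ) < p := by exact_mod_cast hp
    rw [assocMatrix, ← Real.exp_nat_mul]
    congr 1
    field_simp
  · have hp' : (0 : ℝ) < p := by exact_mod_cast hp
    rw [Real.exp_le_exp]
    exact hω.youngConj_div_mono (by positivity) (by push_cast; nlinarith)
  · have hp' : (0 : ℝ) < p := by exact_mod_cast hp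
    have hq' : (p : ℝ) ≤ q := by exact_mod_cast hpq
    have hq0 : (0 : ℝ) < q := by linarith
    have hp1 : (1 : ℝ) ≤ p := by exact_mod_cast hp
    have h1 := hB (ℓ * p) (ℓ * q) (le_mul_of_one_le_right hℓ.le hp1) (by gcongr)
    rw [Real.log_mul hℓ.ne' hq0.ne', Real.log_mul hℓ.ne' hp'.ne'] at h1
    have h2 : ∀ r : ℕ, (0 : ℝ) < r → Real.exp (youngConj ω (ℓ * r) / (ℓ * r)) / r =
        Real.exp (youngConj ω (ℓ * r) / (ℓ * r) - Real.log r) := fun r hr => by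
      rw [Real.exp_sub, Real.exp_log hr]
    rw [h2 p hp', h2 q hq0, ← Real.exp_add, Real.exp_le_exp]
    linarith
  · refine Real.tendsto_exp_atTop.comp (Filter.tendsto_atTop.2 fun b => ?_)
    filter_upwards [hlarge (ω (Real.exp (max (b + 1) 0))), hlarge 1] with p hp hp1
    have h0 : 0 < ℓ * (p : ℝ) := by linarith
    have h1 := hω.hasYoungConj.le h0.le (le_max_right (b + 1) 0)
    have h2 := le_max_left (b + 1) 0
    rw [le_div_iff₀ h0]
    nlinarith
  · have key : Tendsto (fun p : ℕ => Real.log p - youngConj ω (ℓ * p) / (ℓ * p)) atTop atTop := by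
      refine Filter.tendsto_atTop.2 fun b => ?_
      -- With `β = b + log ℓ` and `x = ℓ p` this says `ω (e^y) ≥ e^β (e^y - c)`. The tangent
      -- inequality at `β + y - log x` then gives `x y - ω (e^y) ≤ x (log x - β - 1) + e^β c`, whose
      -- last term is at most `x` for large `p`.
      obtain ⟨c, hc, h⟩ := hω.self_le hC (ε := Real.exp (-(b + Real.log ℓ))) (Real.exp_pos _)
      filter_upwards [hlarge (Real.exp (b + Real.log ℓ) * c), hlarge 1] with p hp hp1
      have h0 : 0 < ℓ * (p : ℝ) := by linarith
      have hp0 : (0 : ℝ) < p := pos_of_mul_pos_right h0 hℓ.le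
      suffices youngConj ω (ℓ * p) ≤ (Real.log p - b) * (ℓ * p) by
        rw [← div_le_iff₀ h0] at this
        linarith
      refine youngConj_le fun y _ => ?_
      have h1 := h _ (Real.exp_pos y).le
      have h2 := mul_le_mul_of_nonneg_left h1 (Real.exp_pos (b + Real.log ℓ)).le
      rw [mul_add, ← mul_assoc, ← Real.exp_add, ← Real.exp_add, add_neg_cancel, Real.exp_zero,
        one_mul] at h2
      have h3 := Real.add_one_le_exp (b + Real.log ℓ + y - Real.log (ℓ * p))
      rw [Real.exp_sub, Real.exp_log h0, le_div_iff₀ h0, Real.log_mul hℓ.ne' hp0.ne'] at h3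
      nlinarith
    refine (Real.tendsto_exp_atTop.comp key).congr' ?_
    filter_upwards [eventually_ge_atTop 1] with p hp
    have hp0 : (0 : ℝ) < p := by exact_mod_cast hp
    rw [Function.comp_apply, Real.exp_sub, Real.exp_log hp0]

/-! ### The spaces defined by the conjugate weight function -/

/-- Moderate growth of `ω*` absorbs geometric factors into the parameter `ℓ`, while `ω* (θ s) ≤ θ ω*
s` for `θ ≤ 1` turns a change of `ℓ` into a geometric factor. -/
lemma weightFamily_conjWeight_equiv_seqFamily (hω : IsBMTWeight ω)
    (hC : (fun t : ℝ => t) =o[atTop] ω) (hγ : upperIndex ω < 1) :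
    FamilyEquiv (weightFamily (conjWeight ω)) (seqFamily (assocMatrix (conjWeight ω) 1)) := by
  have hY := hω.hasYoungConj_conjWeight hC
  have hshrink : ∀ θ ℓ : ℝ, 0 < θ → θ ≤ 1 → 0 < ℓ → ∃ c : ℝ, 0 < c ∧ ∀ p,
      θ ^ p * assocMatrix (conjWeight ω) ℓ p ≤ c * assocMatrix (conjWeight ω) (θ * ℓ) p :=
    fun θ ℓ hθ hθ1 hℓ => hY.assocMatrix_dilation (C' := 0) hθ hθ (fun t ht => by
      rw [add_zero]
      exact (hω.hasConj hC).conjWeight_mul_le hω.nonneg hθ.le hθ1 ht) hℓ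
  refine ⟨fun ℓ => ?_, fun b => ?_, fun b => ?_, fun ℓ => ?_⟩
  · obtain ⟨ℓ, hℓ⟩ := ℓ
    have hm : 1 ≤ max ℓ 1 := le_max_right _ _
    have hm0 : 0 < max ℓ 1 := by linarith
    obtain ⟨c, hc, h1⟩ := hY.assocMatrix_mono hℓ (le_max_left ℓ 1)
    obtain ⟨c', hc', h2⟩ := hshrink (max ℓ 1)⁻¹ (max ℓ 1) (by positivity)
      (inv_le_one_of_one_le₀ hm) hm0
    refine ⟨⟨max ℓ 1, hm0⟩, c * c', by positivity, fun p => (h1 p).trans ?_⟩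
    have h3 := h2 p
    rw [inv_mul_cancel₀ hm0.ne', inv_pow, inv_mul_eq_div, div_le_iff₀' (by positivity)] at h3
    calc _ ≤ c * (max ℓ 1 ^ p * (c' * assocMatrix (conjWeight ω) 1 p)) :=
          mul_le_mul_of_nonneg_left h3 hc.le
      _ = _ := by simp only [seqFamily]; ring
  · obtain ⟨b, hb⟩ := b
    obtain ⟨C, hC0, C', h⟩ := hω.conjWeight_moderate hC hγ hb
    refine ⟨⟨C, hC0⟩, ?_⟩
    have := hY.assocMatrix_dilation hC0 hb h one_pos
    rwa [mul_one] at this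
  · obtain ⟨b, hb⟩ := b
    have hb' : 0 < b := hb
    obtain ⟨C, hC0, C', h⟩ := hω.conjWeight_moderate hC hγ (inv_pos.2 hb')
    obtain ⟨c, hc, h1⟩ := hY.assocMatrix_dilation hC0 (inv_pos.2 hb') h (inv_pos.2 hC0)
    refine ⟨⟨C⁻¹, inv_pos.2 hC0⟩, c, hc, fun p => ?_⟩
    have h2 := h1 p
    rw [mul_inv_cancel₀ hC0.ne', inv_pow, inv_mul_eq_div, div_le_iff₀' (by positivity)] at h2
    calc _ ≤ b ^ p * (c * assocMatrix (conjWeight ω) 1 p) := h2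
      _ = _ := by simp only [seqFamily]; ring
  · obtain ⟨ℓ, hℓ⟩ := ℓ
    have hm0 : 0 < min ℓ 1 := lt_min hℓ one_pos
    obtain ⟨c, hc, h1⟩ := hY.assocMatrix_mono hm0 (min_le_left ℓ 1)
    obtain ⟨c', hc', h2⟩ := hshrink (min ℓ 1) 1 hm0 (min_le_right _ _) one_pos
    refine ⟨⟨min ℓ 1, hm0⟩, c' * c, by positivity, fun p => (h2 p).trans ?_⟩
    rw [mul_one, mul_assoc]
    exact mul_le_mul_of_nonneg_left (h1 p) hc'.le

/-- The weight functions of all sequences equivalent to the conjugate of a sequence of the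
associated weight matrix define the same family as the conjugate weight function. -/
lemma weightFamily_assocWeight_equiv (hω : IsBMTWeight ω) (hC : (fun t : ℝ => t) =o[atTop] ω)
    (hγ : upperIndex ω < 1) {ℓ : ℝ} (hℓ : 0 < ℓ) {N : ℕ → ℝ} (hN : ∀ p, 0 < N p)
    (h : SeqDom N (conjSeq (assocMatrix ω ℓ))) (h' : SeqDom (conjSeq (assocMatrix ω ℓ)) N) :
    FamilyEquiv (weightFamily (conjWeight ω)) (weightFamily (assocWeight N)) := by
  obtain ⟨hb, h1, h2⟩ := hω.assocWeight_equiv_conjWeight hC hγ hℓ hN h h'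
  have hY := hω.hasYoungConj_conjWeight hC
  exact weightFamily_equiv hY (hY.of_weightLE (hb.nonneg hN) h2) h2 h1

/-- Conjugation turns the constant factors in the equivalence of `ω` with its associated function
into dilations of the argument, which `ω*` tolerates. -/
lemma weightFamily_conjWeight_assocWeight_equiv (hω : IsBMTWeight ω)
    (hC : (fun t : ℝ => t) =o[atTop] ω) (hγ : upperIndex ω < 1) {ℓ : ℝ} (hℓ : 0 < ℓ) :
    FamilyEquiv (weightFamily (conjWeight ω))
      (weightFamily (conjWeight (assocWeight (assocMatrix ω ℓ)))) := by
  have hY := hω.hasYoungConj_conjWeight hC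
  have hle := hω.weightLE_assocWeight hℓ
  have hconj : HasConj (assocWeight (assocMatrix ω ℓ)) := (hω.hasConj hC).of_weightLE hle
  have hzero : assocWeight (assocMatrix ω ℓ) 0 = 0 := by
    simp only [assocWeight, assocWeight_term_zero (assocMatrix_pos ω ℓ), ciSup_const]
  obtain ⟨A, hA, A', hA'⟩ := hle
  obtain ⟨B, hB, B', hB'⟩ := hω.assocWeight_weightLE hℓ
  obtain ⟨C, hC0, C', h⟩ := hω.conjWeight_moderate hC hγ hA
  obtain ⟨D, hD0, D', h'⟩ := hω.conjWeight_moderate hC hγ hB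
  have h1 : WeightLE (conjWeight (assocWeight (assocMatrix ω ℓ))) (conjWeight ω) := by
    refine ⟨C / A, by positivity, (C' + A') / A, fun s hs => ?_⟩
    refine ((hω.hasConj hC).conjWeight_le_of_le hA hA' hs).trans ?_
    rw [div_mul_eq_mul_div, ← add_div]
    exact div_le_div_of_nonneg_right (by linarith [h s hs]) hA.le
  have h2 : WeightLE (conjWeight ω) (conjWeight (assocWeight (assocMatrix ω ℓ))) := by
    refine ⟨D / B, by positivity, D * B' / B + D', fun s hs => ?_⟩
    have h3 := h' (s / B) (by positivity)
    have h4 := hconj.conjWeight_le_of_le hB hB' (s := s / B) (by positivity)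
    rw [mul_div_cancel₀ _ hB.ne'] at h3 h4
    refine h3.trans ((add_le_add_left (mul_le_mul_of_nonneg_left h4 hD0.le) D').trans_eq ?_)
    ring
  exact weightFamily_equiv hY
    (hY.of_weightLE (fun s hs => hconj.conjWeight_nonneg hzero hs) h2) h2 h1

lemma weightFamily_equiv_seqFamily_conjSeq (hω : IsBMTWeight ω)
    (hC : (fun t : ℝ => t) =o[atTop] ω) (hγ : upperIndex ω < 1) {ℓ : ℝ} (hℓ : 0 < ℓ) :
    FamilyEquiv (weightFamily (conjWeight ω)) (seqFamily (conjSeq (assocMatrix ω ℓ))) := by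
  obtain ⟨V, hV, -, hLC⟩ := hω.exists_isRegularization hC hγ hℓ
  have hW := assocMatrix_pos ω ℓ
  have h1 := (hV.equiv.1.seqDom hV.pos hW).conjSeq hV.pos hW
  have h2 := (hV.equiv.2.seqDom hW hV.pos).conjSeq hW hV.pos
  obtain ⟨hb, -, hle⟩ := hω.assocWeight_equiv_conjWeight hC hγ hℓ hLC.pos h2 h1
  have hE := hω.weightFamily_assocWeight_equiv hC hγ hℓ hLC.pos h2 h1
  have hS := hω.weightFamily_conjWeight_equiv_seqFamily hC hγ
  have hN := assocMatrix_assocWeight hLC.pos hLC.zero_eq_one hLC.one_le hLC.logConvex hb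
    ((hω.hasYoungConj_conjWeight hC).of_weightLE (hb.nonneg hLC.pos) hle)
  -- At parameter `1` the matrix of the associated function of `conjSeq V` is `conjSeq V` itself.
  -- The Roumieu relation fixes the smaller family's index, so it yields this upper bound; the
  -- Beurling relation, which fixes the larger one's, yields `h4`.
  have h3 : SeqDom (conjSeq V) (assocMatrix (conjWeight ω) 1) := by
    obtain ⟨a, c, hc, H⟩ := (hE.roumieu_ge.trans hS.roumieu_le) ⟨1, Set.mem_Ioi.2 one_pos⟩
    refine ⟨c, a, hc, a.2, fun p => ?_⟩
    have := H p
    simp only [weightFamily, seqFamily, hN] at this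
    rwa [mul_assoc]
  have h4 : SeqDom (assocMatrix (conjWeight ω) 1) (conjSeq V) := by
    obtain ⟨⟨a, ha⟩, c, hc, H⟩ :=
      (hS.beurling_ge.trans hE.beurling_le) ⟨1, Set.mem_Ioi.2 one_pos⟩
    have ha' : 0 < a := ha
    refine ⟨c, a⁻¹, hc, inv_pos.2 ha', fun p => ?_⟩
    have := H p
    simp only [weightFamily, seqFamily, hN] at this
    rw [← le_div_iff₀' (by positivity)] at this
    refine this.trans_eq ?_
    rw [inv_pow]
    field_simp
  exact hS.trans (seqFamily_equiv (h4.trans h2) (h1.trans h3))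

end IsBMTWeight

/-! ### The chain of equalities -/

section Spaces

variable {d : ℕ} (T : ClassType) (U : TopologicalSpace.Opens (EuclideanSpace ℝ (Fin d)))

lemma spaceOfWeight_eq_ultraSpace (σ : ℝ → ℝ) :
    spaceOfWeight T U σ = ultraSpace T U (weightFamily σ) := rfl

lemma spaceOfSeq_eq_ultraSpace (M : ℕ → ℝ) :
    spaceOfSeq T U M = ultraSpace T U (seqFamily M) := rfl

lemma spaceOfMatrix_eq_ultraSpace (M : ℝ → ℕ → ℝ) :
    spaceOfMatrix T U M = ultraSpace T U (matrixFamily M) := rfl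

end Spaces

end

theorem theorem5p6 (ω : ℝ → ℝ) (hω : IsBMTWeight ω)
    (hC : (fun t : ℝ => t) =o[atTop] ω) (hγ : upperIndex ω < 1) :
    (∃ V : ℝ → ℕ → ℝ, ∀ ℓ : ℝ, 0 < ℓ →
      IsRegularization (assocMatrix ω ℓ) (V ℓ) ∧ IsLC (V ℓ) ∧ IsLC (conjSeq (V ℓ))) ∧
    ∀ V : ℝ → ℕ → ℝ, (∀ ℓ : ℝ, 0 < ℓ → IsRegularization (assocMatrix ω ℓ) (V ℓ)) →
      ∀ (T : ClassType) (d : ℕ) (U : TopologicalSpace.Opens (EuclideanSpace ℝ (Fin d)))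
        (ℓ : ℝ), 0 < ℓ →
        spaceOfWeight T U (conjWeight ω) =
            spaceOfWeight T U (conjWeight (assocWeight (assocMatrix ω ℓ))) ∧
          spaceOfWeight T U (conjWeight (assocWeight (assocMatrix ω ℓ))) =
            spaceOfWeight T U (assocWeight (conjSeq (assocMatrix ω ℓ))) ∧
          spaceOfWeight T U (assocWeight (conjSeq (assocMatrix ω ℓ))) =
            spaceOfWeight T U (assocWeight (conjSeq (V ℓ))) ∧
          spaceOfWeight T U (assocWeight (conjSeq (V ℓ))) =
            spaceOfMatrix T U (conjMatrix V) ∧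
          spaceOfMatrix T U (conjMatrix V) =
            spaceOfMatrix T U (conjMatrix (assocMatrix ω)) ∧
          spaceOfMatrix T U (conjMatrix (assocMatrix ω)) =
            spaceOfSeq T U (conjSeq (assocMatrix ω ℓ)) := by
  refine ⟨?_, fun V hV T d U ℓ hℓ => ?_⟩
  · have h : ∀ ℓ : ℝ, ∃ V : ℕ → ℝ, 0 < ℓ →
        IsRegularization (assocMatrix ω ℓ) V ∧ IsLC V ∧ IsLC (conjSeq V) := fun ℓ => by
      by_cases hℓ : 0 < ℓ
      · obtain ⟨V, hV⟩ := hω.exists_isRegularization hC hγ hℓ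
        exact ⟨V, fun _ => hV⟩
      · exact ⟨0, fun h => absurd h hℓ⟩
    exact ⟨fun ℓ => (h ℓ).choose, fun ℓ => (h ℓ).choose_spec⟩
  have hW := assocMatrix_pos ω
  have hdom : ∀ ℓ, 0 < ℓ → ∀ ℓ', 0 < ℓ' →
      SeqDom (conjSeq (assocMatrix ω ℓ)) (conjSeq (assocMatrix ω ℓ')) := fun ℓ hℓ ℓ' hℓ' =>
    (hω.assocMatrix_seqDom hγ hℓ' hℓ).conjSeq (hW ℓ') (hW ℓ)
  have hVW : ∀ ℓ, 0 < ℓ → SeqDom (conjSeq (V ℓ)) (conjSeq (assocMatrix ω ℓ)) := fun ℓ hℓ =>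
    ((hV ℓ hℓ).equiv.2.seqDom (hW ℓ) (hV ℓ hℓ).pos).conjSeq (hW ℓ) (hV ℓ hℓ).pos
  have hWV : ∀ ℓ, 0 < ℓ → SeqDom (conjSeq (assocMatrix ω ℓ)) (conjSeq (V ℓ)) := fun ℓ hℓ =>
    ((hV ℓ hℓ).equiv.1.seqDom (hV ℓ hℓ).pos (hW ℓ)).conjSeq (hV ℓ hℓ).pos (hW ℓ)
  have hweight_pos : ∀ (σ : ℝ → ℝ) (k : Set.Ioi (0 : ℝ)) (p : ℕ), 0 < weightFamily σ k p :=
    fun σ k p => assocMatrix_pos σ k p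
  have hmatrix_pos : ∀ M : ℝ → ℕ → ℝ, (∀ ℓ, 0 < ℓ → ∀ p, 0 < M ℓ p) →
      ∀ q p, 0 < matrixFamily (conjMatrix M) q p := fun M hM q p =>
    mul_pos (pow_pos q.2.2 p) (conjSeq_pos (hM _ (one_div_pos.2 q.1.2)) p)
  have hseq_pos : ∀ q p, 0 < seqFamily (conjSeq (assocMatrix ω ℓ)) q p := fun q p =>
    mul_pos (pow_pos q.2 p) (conjSeq_pos (hW ℓ) p)
  have h1 := hω.weightFamily_conjWeight_assocWeight_equiv hC hγ hℓ
  have h2 := hω.weightFamily_assocWeight_equiv hC hγ hℓ (conjSeq_pos (hW ℓ)) (.refl _) (.refl _)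
  have h3 := hω.weightFamily_assocWeight_equiv hC hγ hℓ (conjSeq_pos (hV ℓ hℓ).pos) (hVW ℓ hℓ)
    (hWV ℓ hℓ)
  have h4 := hω.weightFamily_equiv_seqFamily_conjSeq hC hγ hℓ
  have h5 : FamilyEquiv (matrixFamily (conjMatrix V)) (seqFamily (conjSeq (assocMatrix ω ℓ))) :=
    matrixFamily_equiv
      (fun _ hk => (hVW _ (one_div_pos.2 hk)).trans (hdom _ (one_div_pos.2 hk) ℓ hℓ))
      (fun _ hk => (hdom ℓ hℓ _ (one_div_pos.2 hk)).trans (hWV _ (one_div_pos.2 hk)))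
  have h6 : FamilyEquiv (matrixFamily (conjMatrix (assocMatrix ω)))
      (seqFamily (conjSeq (assocMatrix ω ℓ))) :=
    matrixFamily_equiv (fun _ hk => hdom _ (one_div_pos.2 hk) ℓ hℓ)
      (fun _ hk => hdom ℓ hℓ _ (one_div_pos.2 hk))
  have hVpos := hmatrix_pos V fun ℓ hℓ => (hV ℓ hℓ).pos
  have hWpos := hmatrix_pos (assocMatrix ω) fun ℓ _ => hW ℓ
  simp only [spaceOfWeight_eq_ultraSpace, spaceOfSeq_eq_ultraSpace, spaceOfMatrix_eq_ultraSpace]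
  exact ⟨ultraSpace_eq (hweight_pos _) (hweight_pos _) h1 T,
    ultraSpace_eq (hweight_pos _) (hweight_pos _) (h1.symm.trans h2) T,
    ultraSpace_eq (hweight_pos _) (hweight_pos _) (h2.symm.trans h3) T,
    ultraSpace_eq (hweight_pos _) hVpos (h3.symm.trans (h4.trans h5.symm)) T,
    ultraSpace_eq hVpos hWpos (h5.trans h6.symm) T, ultraSpace_eq hWpos hseq_pos h6 T⟩
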